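/- **Theorem.** Let $d\ge 1$, $0<p_0<p<p_1<\infty$, $K\ge 1$ and $C_0,N,A\ge 0$. There is a constant $C$, depending only on $d,K,p_0,p_1,p,C_0,N,A$, such that the following holds. Let $E,F$ be real normed spaces, and write $|\cdot|$ for their norms. Let $L^\infty_c(\mathbb{R}^d)$ be the space of bounded (strongly Lebesgue) measurable functions $\mathbb{R}^d\to E$ with compact support, and let $T$ be an operator which maps functions $\mathbb{R}^d\to E$ to functions $\mathbb{R}^d\to F$ and is sublinear, in the sense that $$|T(f+g)|\le K\{|T(f)|+|T(g)|\}\quad\text{a.e. in }\mathbb{R}^d,\ \text{ for all } f,g\in L^\infty_c(\mathbb{R}^d).$$ Let $\omega\in L^1_{\rm loc}(\mathbb{R}^d)$ be a nonnegative $A_{p/p_0}$ weight with constant at most $A$; that is, with $q=p/p_0$, $$\langle\omega\rangle_B\,\big\langle\omega^{-\frac1{q-1}}\big\rangle_B^{\,q-1}\le A\quad\text{for every ball } B\subset\mathbb{R}^d,$$ where $\langle u\rangle_B=\frac1{|B|}\int_B u\,dx$ denotes the average with respect to Lebesgue measure. Suppose that 1. $T$ is bounded in the $L^{p_0}$ norm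 on $L^\infty_c(\mathbb{R}^d)$ (in particular, this holds if $T$ is bounded on $L^{p_0}(\mathbb{R}^d)$ with norm at most $C_0$): for all $f\in L^\infty_c(\mathbb{R}^d)$, $T(f)\in L^{p_0}(\mathbb{R}^d)$ and $\|T(f)\|_{L^{p_0}}\le C_0\|f\|_{L^{p_0}}$; 2. for every ball $B\subset\mathbb{R}^d$ and every $g\in L^\infty_c(\mathbb{R}^d)$ with $\operatorname{supp}(g)\subset\mathbb{R}^d\setminus 4B$, $$\big\langle|T(g)|^{p_1}\omega\big\rangle_B^{1/p_1}\le N\Big\{\big\langle|T(g)|^{p_0}\big\rangle_{3B}^{1/p_0}+\sup_{B'\supset B}\big\langle|g|^{p_0}\big\rangle_{B'}^{1/p_0}\Big\}\,\langle\omega\rangle_B^{1/p_1},$$ where the supremum is over all balls $B'$ containing $B$, and $tB$ is the ball with the same center as $B$ and $t$ times its radius. Then for every $f\in L^\infty_c(\mathbb{R}^d)$, $$\int_{\mathbb{R}^d}|T(f)|^p\,\omega\,dx\le C\int_{\mathbb{R}^d}|f|^p\,\omega\,dx.$$ -/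

import Mathlib

open MeasureTheory Metric
open scoped NNReal ENNReal

/-- `IsApWeight d q A ω`: for an exponent `1 < q < ∞`, the function `ω` on `ℝ^d` is an `A_q` weight
whose `A_q` constant is at most `A`, i.e. `ω` is nonnegative, locally integrable, and
`(⨍_B ω) * (⨍_B ω ^ (-1 / (q - 1))) ^ (q - 1) ≤ A` for every ball `B`. The averages are taken
in `[0, ∞]`, so that `0 ^ (-1 / (q - 1)) = ∞` there. -/
structure IsApWeight (d : ℕ) (q : ℝ) (A : ℝ≥0) (ω : EuclideanSpace ℝ (Fin d) → ℝ) : Prop where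
  nonneg : ∀ x, 0 ≤ ω x
  locallyIntegrable : LocallyIntegrable ω volume
  average_mul_average_le : ∀ (c : EuclideanSpace ℝ (Fin d)) (r : ℝ), 0 < r →
    (⨍⁻ x in ball c r, ENNReal.ofReal (ω x) ∂volume) *
      (⨍⁻ x in ball c r, ENNReal.ofReal (ω x) ^ (-1 / (q - 1)) ∂volume) ^ (q - 1) ≤ A

/-- The space `L^∞_c(ℝ^d; E)` of bounded (Lebesgue) measurable functions with compact support. -/
structure IsBoundedCompactlySupported {d : ℕ} {E : Type*} [NormedAddCommGroup E]
    (f : EuclideanSpace ℝ (Fin d) → E) : Prop where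
  aestronglyMeasurable : AEStronglyMeasurable f volume
  bounded : ∃ M : ℝ, ∀ x, ‖f x‖ ≤ M
  hasCompactSupport : HasCompactSupport f

/-- `|T(f + g)| ≤ K (|T f| + |T g|)` almost everywhere, for `f, g ∈ L^∞_c`. -/
def IsSublinearWith {d : ℕ} {E F : Type*} [NormedAddCommGroup E] [NormedAddCommGroup F]
    (K : ℝ≥0) (T : (EuclideanSpace ℝ (Fin d) → E) → (EuclideanSpace ℝ (Fin d) → F)) : Prop :=
  ∀ f g : EuclideanSpace ℝ (Fin d) → E,
    IsBoundedCompactlySupported f → IsBoundedCompactlySupported g →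
    ∀ᵐ x ∂(volume : Measure (EuclideanSpace ℝ (Fin d))),
      ‖T (f + g) x‖ ≤ K * (‖T f x‖ + ‖T g x‖)

/-- `T f ∈ L^{p₀}` and `‖T f‖_{L^{p₀}} ≤ C₀ ‖f‖_{L^{p₀}}`, required only for `f ∈ L^∞_c`; every
operator that is bounded on the whole of `L^{p₀}` with norm at most `C₀` satisfies this. -/
def IsLpBoundedWith {d : ℕ} {E F : Type*} [NormedAddCommGroup E] [NormedAddCommGroup F]
    (p₀ : ℝ) (C₀ : ℝ≥0)
    (T : (EuclideanSpace ℝ (Fin d) → E) → (EuclideanSpace ℝ (Fin d) → F)) : Prop :=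
  ∀ f : EuclideanSpace ℝ (Fin d) → E, IsBoundedCompactlySupported f →
    MemLp (T f) (ENNReal.ofReal p₀) volume ∧
      eLpNorm (T f) (ENNReal.ofReal p₀) volume ≤ C₀ * eLpNorm f (ENNReal.ofReal p₀) volume

/-- The weighted reverse Hölder condition for the individual weight `ω`: for every ball
`B = B(c, r)` and every `g ∈ L^∞_c` with `supp g ⊆ ℝ^d \ 4B`,
`(⨍_B |T g|^{p₁} ω)^{1/p₁}
  ≤ N { (⨍_{3B} |T g|^{p₀})^{1/p₀} + sup_{B' ⊇ B} (⨍_{B'} |g|^{p₀})^{1/p₀} } (⨍_B ω)^{1/p₁}`,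
where `B'` ranges over the balls that contain `B`. -/
def WeightedReverseHolder {d : ℕ} {E F : Type*} [NormedAddCommGroup E] [NormedAddCommGroup F]
    (p₀ p₁ : ℝ) (N : ℝ≥0) (ω : EuclideanSpace ℝ (Fin d) → ℝ)
    (T : (EuclideanSpace ℝ (Fin d) → E) → (EuclideanSpace ℝ (Fin d) → F)) : Prop :=
  ∀ (c : EuclideanSpace ℝ (Fin d)) (r : ℝ), 0 < r →
    ∀ g : EuclideanSpace ℝ (Fin d) → E, IsBoundedCompactlySupported g →
      tsupport g ⊆ (ball c (4 * r))ᶜ →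
      (⨍⁻ x in ball c r, ‖T g x‖ₑ ^ p₁ * ENNReal.ofReal (ω x) ∂volume) ^ (1 / p₁) ≤
        N * ((⨍⁻ x in ball c (3 * r), ‖T g x‖ₑ ^ p₀ ∂volume) ^ (1 / p₀) +
            ⨆ (c' : EuclideanSpace ℝ (Fin d)) (r' : ℝ) (_ : ball c r ⊆ ball c' r'),
              (⨍⁻ x in ball c' r', ‖g x‖ₑ ^ p₀ ∂volume) ^ (1 / p₀)) *
          (⨍⁻ x in ball c r, ENNReal.ofReal (ω x) ∂volume) ^ (1 / p₁)

open Set Filter Topology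

/-! Put `h = |T f|^p₀`, `g = |f|^p₀`, `q = p/p₀`, `s = p₁/p₀`, so `1 < q < s`, and the claim is that
`g` controls `h` in `L^q(w)`. On each ball `B`, cutting `f` along `4B` bounds `h` by a multiple of
`h₁ + h₂`: the `L^{p₀}` bound of `T` makes the integral of `h₁` small where `g` is small, and `h₂`
satisfies the weighted reverse Hölder inequality.

With `M` the maximal function, this yields (`exists_good_lambda`) `w{Mh > αa, Mg ≤ γa} ≤ C α^{-s}
w{Mh > a}`. The `A_∞` property (`exists_withDensity_le_of_volume_le`) turns the weak (1,1) bound for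
`h₁` into a bound in `w`; the boundedness of `M` on `L^s(w)`
(`exists_lintegral_maximalFunction_rpow_le_of_lt`) handles `h₂`. Since `s > q`, a large `α` makes `C
α^{q-s} ≤ 1/2`, and the term in `Mh` is absorbed (`lintegral_rpow_le_of_good_lambda`). Muckenhoupt's
theorem in `L^q(w)` removes `M` from `g`, and `h ≤ Mh` almost everywhere.

All this is done inside `B(0, R)`, for levels `a ≥ ‖h‖₁ / |B(0, R)|`, which keep the stopping radii
below `R`. The lower levels cost `‖h‖₁^q w(B(0, R)) / |B(0, R)|^q`, which tends to zero
(`tendsto_withDensity_ball_div`) because the dual weight has infinite mass. -/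

/-! ### Layer-cake formula for extended nonnegative functions -/

/-- A finite value is the layer-cake formula for a Dirac mass; the value `∞` dominates every finite
one. Tonelli then gives the integrated formula for functions that may be infinite. -/
theorem lintegral_rpow_layer (a : ℝ≥0∞) {s : ℝ} (hs : 0 < s) :
    a ^ s = ENNReal.ofReal s * ∫⁻ t in Ioi (0 : ℝ),
      (if ENNReal.ofReal t < a then ENNReal.ofReal (t ^ (s - 1)) else 0) := by
  have fin : ∀ b : ℝ≥0, (b : ℝ≥0∞) ^ s = ENNReal.ofReal s * ∫⁻ t in Ioi (0 : ℝ),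
      (if ENNReal.ofReal t < b then ENNReal.ofReal (t ^ (s - 1)) else 0) := by
    intro b
    have h := lintegral_rpow_eq_lintegral_meas_lt_mul (Measure.dirac (0 : ℝ))
      (f := fun _ => (b : ℝ)) (Eventually.of_forall fun _ => b.coe_nonneg)
      aemeasurable_const hs
    rw [lintegral_dirac, ← ENNReal.ofReal_rpow_of_nonneg b.coe_nonneg hs.le,
      ENNReal.ofReal_coe_nnreal] at h
    rw [h]
    congr 1
    refine setLIntegral_congr_fun measurableSet_Ioi fun t ht => ?_
    have ht' : (ENNReal.ofReal t < b) ↔ t < b := by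
      rw [← ENNReal.ofReal_coe_nnreal]
      exact ENNReal.ofReal_lt_ofReal_iff_of_nonneg (le_of_lt ht)
    by_cases hb : t < b
    · simp [hb, ht']
    · simp [hb, ht']
  induction a with
  | coe b => exact fin b
  | top =>
    rw [ENNReal.top_rpow_of_pos hs]
    symm
    rw [eq_top_iff]
    refine le_of_forall_lt fun c hc => ?_
    obtain ⟨b, hb⟩ : ∃ b : ℝ≥0, c < (b : ℝ≥0∞) ^ s := by
      lift c to ℝ≥0 using hc.ne
      refine ⟨(c + 1) ^ (1 / s), ?_⟩
      rw [← ENNReal.coe_rpow_of_nonneg _ hs.le, ← NNReal.rpow_mul, one_div_mul_cancel hs.ne',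
        NNReal.rpow_one]
      exact_mod_cast lt_add_one c
    refine hb.trans_le ?_
    rw [fin b]
    gcongr with t
    split_ifs with h1 h2 h2
    · exact le_rfl
    · exact absurd (h1.trans_le le_top) h2
    · exact zero_le
    · exact le_rfl

theorem lintegral_rpow_eq_lintegral_meas_lt {α : Type*} [MeasurableSpace α] (μ : Measure α)
    [SFinite μ] {u : α → ℝ≥0∞} (hu : Measurable u) {s : ℝ} (hs : 0 < s) :
    ∫⁻ x, u x ^ s ∂μ = ENNReal.ofReal s * ∫⁻ t in Ioi (0 : ℝ),
      μ {x | ENNReal.ofReal t < u x} * ENNReal.ofReal (t ^ (s - 1)) := by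
  have hS : MeasurableSet {z : α × ℝ | ENNReal.ofReal z.2 < u z.1} :=
    measurableSet_lt (ENNReal.measurable_ofReal.comp measurable_snd) (hu.comp measurable_fst)
  have hm : Measurable (fun z : α × ℝ =>
      if ENNReal.ofReal z.2 < u z.1 then ENNReal.ofReal (z.2 ^ (s - 1)) else 0) :=
    Measurable.ite hS (by fun_prop) measurable_const
  simp_rw [lintegral_rpow_layer _ hs]
  rw [lintegral_const_mul' _ _ ENNReal.ofReal_ne_top]
  congr 1
  rw [lintegral_lintegral_swap hm.aemeasurable]
  refine lintegral_congr fun t => ?_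
  have ht : MeasurableSet {x | ENNReal.ofReal t < u x} := measurableSet_lt measurable_const hu
  rw [mul_comm, ← lintegral_indicator_const ht]
  simp only [indicator, mem_ofPred_eq]

/-! ### Maximal functions of doubling measures -/

section Maximal

variable {X : Type*} [PseudoMetricSpace X] [MeasurableSpace X]

/-- The uncentered Hardy–Littlewood maximal function over balls, relative to `μ`. -/
noncomputable def maximalFunction (μ : Measure X) (h : X → ℝ≥0∞) (x : X) : ℝ≥0∞ :=
  ⨆ (c : X) (r : ℝ) (_ : x ∈ ball c r), (∫⁻ y in ball c r, h y ∂μ) / μ (ball c r)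

/-- Balls have positive finite measure, which grows by a factor at most `D` when the radius is
multiplied by six. -/
structure IsDoublingWith (D : ℝ≥0) (μ : Measure X) : Prop where
  pos : ∀ (c : X) (r : ℝ), 0 < r → μ (ball c r) ≠ 0
  finite : ∀ (c : X) (r : ℝ), μ (ball c r) ≠ ∞
  le : ∀ (c : X) (r : ℝ), 0 < r → μ (ball c (6 * r)) ≤ D * μ (ball c r)

theorem lt_maximalFunction_iff {μ : Measure X} {h : X → ℝ≥0∞} {x : X} {a : ℝ≥0∞} :
    a < maximalFunction μ h x ↔
      ∃ c r, x ∈ ball c r ∧ a < (∫⁻ y in ball c r, h y ∂μ) / μ (ball c r) := by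
  simp [maximalFunction, lt_iSup_iff]

theorem le_maximalFunction (μ : Measure X) (h : X → ℝ≥0∞) {x c : X} {r : ℝ}
    (hx : x ∈ ball c r) :
    (∫⁻ y in ball c r, h y ∂μ) / μ (ball c r) ≤ maximalFunction μ h x :=
  le_iSup_of_le c (le_iSup_of_le r (le_iSup_of_le hx le_rfl))

theorem isOpen_lt_maximalFunction (μ : Measure X) (h : X → ℝ≥0∞) (a : ℝ≥0∞) :
    IsOpen {x | a < maximalFunction μ h x} := by
  have : {x | a < maximalFunction μ h x} = ⋃ (c : X) (r : ℝ)
      (_ : a < (∫⁻ y in ball c r, h y ∂μ) / μ (ball c r)), ball c r := by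
    ext x
    simp only [mem_ofPred_eq, lt_maximalFunction_iff, mem_iUnion, exists_prop]
    tauto
  rw [this]
  exact isOpen_iUnion fun c => isOpen_iUnion fun r => isOpen_iUnion fun _ => isOpen_ball

theorem measurable_maximalFunction [OpensMeasurableSpace X] (μ : Measure X) (h : X → ℝ≥0∞) :
    Measurable (maximalFunction μ h) :=
  measurable_of_Ioi fun a => (isOpen_lt_maximalFunction μ h a).measurableSet

/-- Vitali covering by open balls. -/
theorem exists_countable_disjoint_balls_covering {ι X : Type*} [PseudoMetricSpace X]
    [SecondCountableTopology X] (t : Set ι) (x : ι → X) (r : ι → ℝ) (R : ℝ)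
    (hr0 : ∀ a ∈ t, 0 < r a) (hr : ∀ a ∈ t, r a ≤ R) :
    ∃ u ⊆ t, u.Countable ∧ (u.PairwiseDisjoint fun a => ball (x a) (r a)) ∧
      ∀ a ∈ t, ∃ b ∈ u, ball (x a) (r a) ⊆ ball (x b) (6 * r b) := by
  obtain ⟨u, hut, hdisj, hcov⟩ := Vitali.exists_disjoint_subfamily_covering_enlargement_closedBall
    t x r R hr 5 (by norm_num)
  have hd : u.PairwiseDisjoint fun a => ball (x a) (r a) :=
    fun a ha b hb hab => (hdisj ha hb hab).mono ball_subset_closedBall ball_subset_closedBall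
  refine ⟨u, hut, ?_, hd, fun a ha => ?_⟩
  · refine hd.countable_of_isOpen (fun _ _ => isOpen_ball) fun a ha => ?_
    exact ⟨x a, mem_ball_self (hr0 a (hut ha))⟩
  · obtain ⟨b, hb, h⟩ := hcov a ha
    refine ⟨b, hb, ball_subset_closedBall.trans (h.trans (closedBall_subset_ball ?_))⟩
    linarith [hr0 b (hut hb)]

/-- Vitali covering needs bounded radii, so they are capped at `n`; the bound does not depend on `n`
and the capped level sets increase to the full one. -/
theorem IsDoublingWith.mul_measure_lt_maximalFunction_le [OpensMeasurableSpace X]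
    [SecondCountableTopology X] {D : ℝ≥0} {μ : Measure X} (hμ : IsDoublingWith D μ)
    (h : X → ℝ≥0∞) (a : ℝ≥0∞) :
    a * μ {x | a < maximalFunction μ h x} ≤ D * ∫⁻ x, h x ∂μ := by
  let S : ℕ → Set X := fun n => {x | ∃ (c : X) (r : ℝ), r ≤ n ∧ x ∈ ball c r ∧
    a < (∫⁻ y in ball c r, h y ∂μ) / μ (ball c r)}
  have hS : {x | a < maximalFunction μ h x} = ⋃ n, S n := by
    ext x
    simp only [mem_ofPred_eq, lt_maximalFunction_iff, mem_iUnion, S]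
    constructor
    · rintro ⟨c, r, h1, h2⟩
      obtain ⟨n, hn⟩ := exists_nat_ge r
      exact ⟨n, c, r, hn, h1, h2⟩
    · rintro ⟨n, c, r, -, h1, h2⟩
      exact ⟨c, r, h1, h2⟩
  have hmono : Monotone S := by
    rintro m n hmn x ⟨c, r, h1, h2⟩
    exact ⟨c, r, h1.trans (by exact_mod_cast hmn), h2⟩
  rw [hS, hmono.measure_iUnion, ENNReal.mul_iSup]
  refine iSup_le fun n => ?_
  let t : Set (X × ℝ) := {z | 0 < z.2 ∧ z.2 ≤ n ∧
    a < (∫⁻ y in ball z.1 z.2, h y ∂μ) / μ (ball z.1 z.2)}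
  obtain ⟨u, hut, hu, hd, hcov⟩ := exists_countable_disjoint_balls_covering t Prod.fst Prod.snd n
    (fun z hz => hz.1) (fun z hz => hz.2.1)
  have hsub : S n ⊆ ⋃ z ∈ u, ball z.1 (6 * z.2) := by
    rintro x ⟨c, r, h1, h2, h3⟩
    obtain ⟨b, hb, hb'⟩ := hcov (c, r) ⟨pos_of_mem_ball h2, h1, h3⟩
    exact mem_biUnion hb (hb' h2)
  calc a * μ (S n) ≤ a * ∑' z : u, μ (ball z.1.1 (6 * z.1.2)) := by
        gcongr
        exact (measure_mono hsub).trans (measure_biUnion_le _ hu _)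
    _ = ∑' z : u, a * μ (ball z.1.1 (6 * z.1.2)) := ENNReal.tsum_mul_left.symm
    _ ≤ ∑' z : u, D * ∫⁻ y in ball z.1.1 z.1.2, h y ∂μ := by
        refine ENNReal.tsum_le_tsum fun z => ?_
        obtain ⟨h1, -, h2⟩ := hut z.2
        calc a * μ (ball z.1.1 (6 * z.1.2)) ≤ a * (D * μ (ball z.1.1 z.1.2)) := by
              gcongr; exact hμ.le _ _ h1
          _ = D * (a * μ (ball z.1.1 z.1.2)) := by ring
          _ ≤ _ := by gcongr; exact ENNReal.mul_le_of_le_div h2.le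
    _ = D * ∫⁻ y in ⋃ z ∈ u, ball z.1 z.2, h y ∂μ := by
        rw [ENNReal.tsum_mul_left, lintegral_biUnion hu (fun _ _ => measurableSet_ball) hd]
    _ ≤ _ := by gcongr; exact Measure.restrict_le_self

/-- The part of `h` below `a / 2` adds at most `a / 2` to any average, so only the rest matters.
Restricting the integral in this way makes the layer-cake integral converge for every exponent above
one. -/
theorem IsDoublingWith.mul_measure_lt_maximalFunction_le_setLIntegral [OpensMeasurableSpace X]
    [SecondCountableTopology X] {D : ℝ≥0} {μ : Measure X} (hμ : IsDoublingWith D μ)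
    {h : X → ℝ≥0∞} (hh : Measurable h) (a : ℝ≥0∞) :
    a * μ {x | a < maximalFunction μ h x} ≤ 2 * D * ∫⁻ x in {x | a < 2 * h x}, h x ∂μ := by
  have hm : MeasurableSet {x | a < 2 * h x} := measurableSet_lt measurable_const (hh.const_mul 2)
  set k : X → ℝ≥0∞ := {x | a < 2 * h x}.indicator h with hk
  have hle : ∀ x, maximalFunction μ h x ≤ maximalFunction μ k x + a / 2 := by
    intro x
    refine iSup_le fun c => iSup_le fun r => iSup_le fun hx => ?_
    refine le_trans ?_ (add_le_add_left (le_maximalFunction μ k hx) _)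
    have h1 : ∫⁻ y in ball c r, h y ∂μ ≤
        (∫⁻ y in ball c r, k y ∂μ) + a / 2 * μ (ball c r) := by
      rw [← setLIntegral_const, ← lintegral_add_right _ measurable_const]
      refine lintegral_mono fun y => ?_
      by_cases hy : a < 2 * h y
      · simp [hk, hy]
      · simp only [hk, indicator, mem_ofPred_eq, hy, if_false, zero_add]
        rw [ENNReal.le_div_iff_mul_le (by simp) (by simp), mul_comm]
        exact not_lt.mp hy
    calc _ ≤ ((∫⁻ y in ball c r, k y ∂μ) + a / 2 * μ (ball c r)) / μ (ball c r) := by gcongr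
      _ = (∫⁻ y in ball c r, k y ∂μ) / μ (ball c r) + a / 2 * (μ (ball c r) / μ (ball c r)) := by
        rw [ENNReal.add_div, mul_div_assoc]
      _ ≤ (∫⁻ y in ball c r, k y ∂μ) / μ (ball c r) + a / 2 * 1 := by
        gcongr; exact ENNReal.div_self_le_one
      _ = _ := by rw [mul_one]
  have hsub : {x | a < maximalFunction μ h x} ⊆ {x | a / 2 < maximalFunction μ k x} := by
    intro x hx
    by_contra hcon
    have h1 : maximalFunction μ k x ≤ a / 2 := not_lt.mp hcon
    have h2 := (hle x).trans (add_le_add_left h1 _)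
    rw [ENNReal.add_halves] at h2
    exact absurd hx (not_lt.mpr h2)
  calc a * μ {x | a < maximalFunction μ h x} ≤ a * μ {x | a / 2 < maximalFunction μ k x} := by
        gcongr
    _ = 2 * (a / 2 * μ {x | a / 2 < maximalFunction μ k x}) := by
        rw [← mul_assoc, ENNReal.mul_div_cancel (by simp) (by simp)]
    _ ≤ 2 * (D * ∫⁻ x, k x ∂μ) := by
        gcongr 2 * ?_; exact hμ.mul_measure_lt_maximalFunction_le k _
    _ = _ := by rw [hk, lintegral_indicator hm, mul_assoc]

/-- The Hardy–Littlewood maximal theorem. -/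
theorem IsDoublingWith.lintegral_maximalFunction_rpow_le [OpensMeasurableSpace X]
    [SecondCountableTopology X] {D : ℝ≥0} {μ : Measure X} [SFinite μ] (hμ : IsDoublingWith D μ)
    {h : X → ℝ≥0∞} (hh : Measurable h) {s : ℝ} (hs : 1 < s) :
    ∫⁻ x, maximalFunction μ h x ^ s ∂μ ≤
      ENNReal.ofReal (s / (s - 1)) * (2 ^ s * D) * ∫⁻ x, h x ^ s ∂μ := by
  have hs1 : 0 < s - 1 := by linarith
  -- Under `h dμ` the right-hand integral is itself the measure of a level set, so the layer-cake
  -- formula applies again, with exponent `s - 1`.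
  set ν := μ.withDensity h
  have hν : ∀ t : ℝ, ν {x | ENNReal.ofReal t < 2 * h x} =
      ∫⁻ x in {x | ENNReal.ofReal t < 2 * h x}, h x ∂μ := fun t =>
    withDensity_apply _ (measurableSet_lt measurable_const (hh.const_mul 2))
  have key : ∀ t ∈ Ioi (0 : ℝ), μ {x | ENNReal.ofReal t < maximalFunction μ h x} *
      ENNReal.ofReal (t ^ (s - 1)) ≤
      2 * D * (ν {x | ENNReal.ofReal t < 2 * h x} * ENNReal.ofReal (t ^ (s - 1 - 1))) := by
    intro t ht
    have h1 := hμ.mul_measure_lt_maximalFunction_le_setLIntegral hh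
      (ENNReal.ofReal t)
    have h2 : t ^ (s - 1) = t * t ^ (s - 1 - 1) := by
      rw [← Real.rpow_one_add' (le_of_lt ht) (by linarith)]; ring_nf
    rw [hν, h2, ENNReal.ofReal_mul (le_of_lt ht)]
    calc _ = (ENNReal.ofReal t * μ {x | ENNReal.ofReal t < maximalFunction μ h x}) *
          ENNReal.ofReal (t ^ (s - 1 - 1)) := by ring
      _ ≤ _ := by rw [← mul_assoc]; gcongr
  rw [lintegral_rpow_eq_lintegral_meas_lt μ (measurable_maximalFunction μ h) (by linarith)]
  calc _ ≤ ENNReal.ofReal s * ∫⁻ t in Ioi (0 : ℝ), 2 * D * (ν {x | ENNReal.ofReal t < 2 * h x} *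
        ENNReal.ofReal (t ^ (s - 1 - 1))) := by
        gcongr 1
        exact setLIntegral_mono' measurableSet_Ioi key
    _ = ENNReal.ofReal (s / (s - 1)) * (2 * D) * (ENNReal.ofReal (s - 1) * ∫⁻ t in Ioi (0 : ℝ),
        ν {x | ENNReal.ofReal t < 2 * h x} * ENNReal.ofReal (t ^ (s - 1 - 1))) := by
        rw [lintegral_const_mul' _ _ (by finiteness), show ENNReal.ofReal s =
          ENNReal.ofReal (s / (s - 1)) * ENNReal.ofReal (s - 1) by
            rw [← ENNReal.ofReal_mul (by positivity), div_mul_cancel₀ _ hs1.ne']]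
        ring
    _ = ENNReal.ofReal (s / (s - 1)) * (2 * D) * ∫⁻ x, (2 * h x) ^ (s - 1) ∂ν := by
        rw [lintegral_rpow_eq_lintegral_meas_lt ν (hh.const_mul 2) hs1]
    _ = ENNReal.ofReal (s / (s - 1)) * (2 * D) * ∫⁻ x, 2 ^ (s - 1) * h x ^ s ∂μ := by
        rw [lintegral_withDensity_eq_lintegral_mul _ hh (by fun_prop)]
        congr 1
        refine lintegral_congr fun x => ?_
        have : h x ^ s = h x * h x ^ (s - 1) := by
          rw [show s = 1 + (s - 1) by ring, ENNReal.rpow_add_of_nonneg _ _ zero_le_one hs1.le,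
            ENNReal.rpow_one]
          ring_nf
        rw [Pi.mul_apply, ENNReal.mul_rpow_of_nonneg _ _ hs1.le, this]
        ring
    _ = _ := by
        rw [lintegral_const_mul' _ _ (by finiteness), show (2 : ℝ≥0∞) ^ s = 2 * 2 ^ (s - 1) by
          rw [show s = 1 + (s - 1) by ring, ENNReal.rpow_add_of_nonneg _ _ zero_le_one hs1.le,
            ENNReal.rpow_one]; ring_nf]
        ring

end Maximal

/-! ### Lebesgue measure of balls -/

section Volume

variable {d : ℕ}

theorem volume_ball_mul (c c' : EuclideanSpace ℝ (Fin d)) {a : ℝ} (ha : 0 < a) (r : ℝ) :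
    volume (ball c (a * r)) = ENNReal.ofReal (a ^ d) * volume (ball c' r) := by
  rw [Measure.addHaar_ball_mul_of_pos volume c ha, finrank_euclideanSpace_fin,
    Measure.addHaar_ball_center volume c']

theorem volume_ball_ne_zero (c : EuclideanSpace ℝ (Fin d)) {r : ℝ} (hr : 0 < r) :
    volume (ball c r) ≠ 0 :=
  (measure_ball_pos volume c hr).ne'

theorem volume_ball_ne_top (c : EuclideanSpace ℝ (Fin d)) (r : ℝ) : volume (ball c r) ≠ ∞ :=
  measure_ball_lt_top.ne

theorem isDoublingWith_volume (d : ℕ) :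
    IsDoublingWith (6 ^ d) (volume : Measure (EuclideanSpace ℝ (Fin d))) where
  pos c r hr := volume_ball_ne_zero c hr
  finite c r := volume_ball_ne_top c r
  le c r _ := by
    rw [volume_ball_mul c c (by norm_num), ENNReal.ofReal_pow (by norm_num)]
    simp

end Volume

/-! ### Muckenhoupt weights and weighted maximal functions -/

/-- The weight `w`, of Muckenhoupt class `A_q`, together with its dual weight `σ = w ^ (1 - q')`,
of class `A_{q'}`; the two play symmetric roles. -/
structure IsMuckenhouptPair {d : ℕ} (q q' : ℝ) (A : ℝ≥0) (w σ : EuclideanSpace ℝ (Fin d) → ℝ≥0∞) :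
    Prop where
  conj : q.HolderConjugate q'
  measurable_left : Measurable w
  measurable_right : Measurable σ
  rpow_mul_rpow : ∀ x, w x ^ (1 / q) * σ x ^ (1 / q') = 1
  left_ne_top : ∀ c r, ∫⁻ x in ball c r, w x ≠ ∞
  right_ne_top : ∀ c r, ∫⁻ x in ball c r, σ x ≠ ∞
  le : ∀ c r, 0 < r → (∫⁻ x in ball c r, w x) ^ (1 / q) * (∫⁻ x in ball c r, σ x) ^ (1 / q') ≤
    A * volume (ball c r)

namespace IsMuckenhouptPair

variable {d : ℕ} {q q' : ℝ} {A : ℝ≥0} {w σ : EuclideanSpace ℝ (Fin d) → ℝ≥0∞}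

theorem symm (P : IsMuckenhouptPair q q' A w σ) : IsMuckenhouptPair q' q A σ w where
  conj := P.conj.symm
  measurable_left := P.measurable_right
  measurable_right := P.measurable_left
  rpow_mul_rpow x := by rw [mul_comm]; exact P.rpow_mul_rpow x
  left_ne_top := P.right_ne_top
  right_ne_top := P.left_ne_top
  le c r hr := by rw [mul_comm]; exact P.le c r hr

theorem ne_zero (P : IsMuckenhouptPair q q' A w σ) (x) : w x ≠ 0 := by
  intro h
  have := P.rpow_mul_rpow x
  rw [h, ENNReal.zero_rpow_of_pos P.conj.one_div_pos, zero_mul] at this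
  exact zero_ne_one this

theorem ne_top (P : IsMuckenhouptPair q q' A w σ) (x) : w x ≠ ∞ := by
  intro h
  have h1 := P.rpow_mul_rpow x
  rw [h, ENNReal.top_rpow_of_pos P.conj.one_div_pos, ENNReal.top_mul] at h1
  · exact ENNReal.top_ne_one h1
  · intro h0
    rw [h0, mul_zero] at h1
    exact zero_ne_one h1

theorem rpow_mul (P : IsMuckenhouptPair q q' A w σ) (x) : w x ^ (q' - 1) * σ x = 1 := by
  have h := congrArg (· ^ q') (P.rpow_mul_rpow x)
  simp only [ENNReal.one_rpow] at h
  rw [ENNReal.mul_rpow_of_nonneg _ _ P.conj.symm.nonneg, ← ENNReal.rpow_mul, ← ENNReal.rpow_mul,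
    one_div_mul_cancel P.conj.symm.ne_zero, ENNReal.rpow_one, one_div_mul_eq_div,
    P.conj.symm.div_conj_eq_sub_one] at h
  exact h

theorem inv_rpow_mul (P : IsMuckenhouptPair q q' A w σ) (x) : (w x)⁻¹ ^ q' * w x = σ x := by
  have h := P.rpow_mul x
  rw [mul_comm] at h
  rw [ENNReal.eq_inv_of_mul_eq_one_left h, ENNReal.inv_rpow, ← ENNReal.rpow_neg,
    ← ENNReal.rpow_neg]
  nth_rw 2 [← ENNReal.rpow_one (w x)]
  rw [← ENNReal.rpow_add _ _ (P.ne_zero x) (P.ne_top x)]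
  ring_nf

theorem withDensity_ball (_ : IsMuckenhouptPair q q' A w σ) (c : EuclideanSpace ℝ (Fin d))
    (r : ℝ) : volume.withDensity w (ball c r) = ∫⁻ x in ball c r, w x :=
  withDensity_apply _ measurableSet_ball

theorem setLIntegral_withDensity (P : IsMuckenhouptPair q q' A w σ)
    {s : Set (EuclideanSpace ℝ (Fin d))} (hs : MeasurableSet s)
    (g : EuclideanSpace ℝ (Fin d) → ℝ≥0∞) :
    ∫⁻ x in s, g x ∂(volume.withDensity w) = ∫⁻ x in s, w x * g x :=
  setLIntegral_withDensity_eq_setLIntegral_mul_non_measurable _ P.measurable_left g hs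
    (Eventually.of_forall fun x => (P.ne_top x).lt_top)

theorem lintegral_withDensity (P : IsMuckenhouptPair q q' A w σ)
    (g : EuclideanSpace ℝ (Fin d) → ℝ≥0∞) :
    ∫⁻ x, g x ∂(volume.withDensity w) = ∫⁻ x, w x * g x :=
  lintegral_withDensity_eq_lintegral_mul_non_measurable _ P.measurable_left
    (Eventually.of_forall fun x => (P.ne_top x).lt_top) g

/-- Hölder for the factorization `h = (h w^{1/q}) σ^{1/q'}`. -/
theorem setLIntegral_le (P : IsMuckenhouptPair q q' A w σ)
    {h : EuclideanSpace ℝ (Fin d) → ℝ≥0∞} (hh : Measurable h)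
    {s : Set (EuclideanSpace ℝ (Fin d))} (hs : MeasurableSet s) :
    ∫⁻ x in s, h x ≤
      (∫⁻ x in s, h x ^ q ∂(volume.withDensity w)) ^ (1 / q) * (∫⁻ x in s, σ x) ^ (1 / q') := by
  have hw := P.measurable_left
  have hσ := P.measurable_right
  have key := ENNReal.lintegral_mul_le_Lp_mul_Lq (volume.restrict s) P.conj
    (f := fun x => h x * w x ^ (1 / q)) (g := fun x => σ x ^ (1 / q'))
    (by fun_prop) (by fun_prop)
  rw [P.setLIntegral_withDensity hs]
  calc ∫⁻ x in s, h x =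
        ∫⁻ x in s, ((fun x => h x * w x ^ (1 / q)) * fun x => σ x ^ (1 / q')) x := by
        refine lintegral_congr fun x => ?_
        simp only [Pi.mul_apply]
        rw [mul_assoc, P.rpow_mul_rpow, mul_one]
    _ ≤ _ := key
    _ = _ := by
        congr 2
        · refine lintegral_congr fun x => ?_
          rw [ENNReal.mul_rpow_of_nonneg _ _ P.conj.nonneg, ← ENNReal.rpow_mul,
            one_div_mul_cancel P.conj.ne_zero, ENNReal.rpow_one, mul_comm]
        · refine lintegral_congr fun x => ?_
          rw [← ENNReal.rpow_mul, one_div_mul_cancel P.conj.symm.ne_zero, ENNReal.rpow_one]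

/-- The `A_q` condition as a comparison of averages: for `s` the whole ball, the Lebesgue average of
`h` is at most `A` times its `L^q(w)` average. Subsets `s` are allowed so that `h = 1` compares `|s|
/ |B|` with `w(s) / w(B)`. -/
theorem setLIntegral_mul_le (P : IsMuckenhouptPair q q' A w σ)
    {h : EuclideanSpace ℝ (Fin d) → ℝ≥0∞} (hh : Measurable h)
    {s : Set (EuclideanSpace ℝ (Fin d))} (hs : MeasurableSet s) {c : EuclideanSpace ℝ (Fin d)}
    {r : ℝ} (hr : 0 < r) (hsub : s ⊆ ball c r) :
    (∫⁻ x in s, h x) * volume.withDensity w (ball c r) ^ (1 / q) ≤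
      A * volume (ball c r) * (∫⁻ x in s, h x ^ q ∂(volume.withDensity w)) ^ (1 / q) := by
  have h1 : ∫⁻ x in s, σ x ≤ ∫⁻ x in ball c r, σ x := lintegral_mono_set hsub
  rw [P.withDensity_ball]
  calc _ ≤ ((∫⁻ x in s, h x ^ q ∂(volume.withDensity w)) ^ (1 / q) *
        (∫⁻ x in ball c r, σ x) ^ (1 / q')) * (∫⁻ x in ball c r, w x) ^ (1 / q) := by
        gcongr
        refine (P.setLIntegral_le hh hs).trans ?_
        gcongr
        exact P.conj.symm.one_div_nonneg
    _ = ((∫⁻ x in ball c r, w x) ^ (1 / q) * (∫⁻ x in ball c r, σ x) ^ (1 / q')) *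
        (∫⁻ x in s, h x ^ q ∂(volume.withDensity w)) ^ (1 / q) := by ring
    _ ≤ _ := mul_le_mul_left (P.le c r hr) _

theorem volume_mul_rpow_le (P : IsMuckenhouptPair q q' A w σ)
    {s : Set (EuclideanSpace ℝ (Fin d))} (hs : MeasurableSet s) {c : EuclideanSpace ℝ (Fin d)}
    {r : ℝ} (hr : 0 < r) (hsub : s ⊆ ball c r) :
    volume s * volume.withDensity w (ball c r) ^ (1 / q) ≤
      A * volume (ball c r) * volume.withDensity w s ^ (1 / q) := by
  have h := P.setLIntegral_mul_le (h := fun _ => 1) measurable_const hs hr hsub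
  simpa using h

theorem withDensity_ball_ne_zero (P : IsMuckenhouptPair q q' A w σ)
    (c : EuclideanSpace ℝ (Fin d)) {r : ℝ} (hr : 0 < r) :
    volume.withDensity w (ball c r) ≠ 0 := by
  intro h
  have h1 := P.setLIntegral_le (h := fun _ => 1) measurable_const
    (measurableSet_ball (x := c) (ε := r))
  simp only [ENNReal.one_rpow, lintegral_const, one_mul, Measure.restrict_apply_univ, h] at h1
  rw [ENNReal.zero_rpow_of_pos P.conj.one_div_pos, zero_mul] at h1
  exact volume_ball_ne_zero c hr (le_zero_iff.mp h1)

theorem withDensity_ball_ne_top (P : IsMuckenhouptPair q q' A w σ)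
    (c : EuclideanSpace ℝ (Fin d)) (r : ℝ) : volume.withDensity w (ball c r) ≠ ∞ := by
  rw [P.withDensity_ball]
  exact P.left_ne_top c r

theorem withDensity_ball_mul_le (P : IsMuckenhouptPair q q' A w σ)
    {c c' : EuclideanSpace ℝ (Fin d)} {a r : ℝ} (ha : 0 < a) (hr : 0 < r)
    (hsub : ball c' r ⊆ ball c (a * r)) :
    volume.withDensity w (ball c (a * r)) ≤
      (A * ENNReal.ofReal (a ^ d)) ^ q * volume.withDensity w (ball c' r) := by
  have h := P.volume_mul_rpow_le measurableSet_ball (mul_pos ha hr) hsub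
  rw [volume_ball_mul c c' ha] at h
  have h2 : volume.withDensity w (ball c (a * r)) ^ (1 / q) ≤
      A * ENNReal.ofReal (a ^ d) * volume.withDensity w (ball c' r) ^ (1 / q) := by
    rw [← ENNReal.mul_le_mul_iff_right (volume_ball_ne_zero c' hr) (volume_ball_ne_top c' r)]
    refine h.trans_eq ?_
    ring
  have h3 := ENNReal.rpow_le_rpow h2 P.conj.nonneg
  rwa [ENNReal.mul_rpow_of_nonneg _ _ P.conj.nonneg, ← ENNReal.rpow_mul, ← ENNReal.rpow_mul,
    one_div_mul_cancel P.conj.ne_zero, ENNReal.rpow_one, ENNReal.rpow_one] at h3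

theorem isDoublingWith (P : IsMuckenhouptPair q q' A w σ) :
    IsDoublingWith ((A * 6 ^ d) ^ q) (volume.withDensity w) where
  pos c _ hr := P.withDensity_ball_ne_zero c hr
  finite := P.withDensity_ball_ne_top
  le c r hr := by
    have h := P.withDensity_ball_mul_le (c := c) (c' := c) (a := 6) (by norm_num) hr
      (ball_subset_ball (by linarith))
    rw [ENNReal.ofReal_pow (by norm_num)] at h
    rw [ENNReal.coe_rpow_of_nonneg _ P.conj.nonneg]
    simpa using h

theorem maximalFunction_le (P : IsMuckenhouptPair q q' A w σ)
    {h : EuclideanSpace ℝ (Fin d) → ℝ≥0∞} (hh : Measurable h) (x : EuclideanSpace ℝ (Fin d)) :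
    maximalFunction volume h x ≤
      A * maximalFunction (volume.withDensity w) (fun y => h y ^ q) x ^ (1 / q) := by
  refine iSup_le fun c => iSup_le fun r => iSup_le fun hx => ?_
  have hr : 0 < r := pos_of_mem_ball hx
  have h1 := P.setLIntegral_mul_le hh measurableSet_ball hr (subset_refl (ball c r))
  have hw0 := P.withDensity_ball_ne_zero c hr
  have hwt := P.withDensity_ball_ne_top c r
  have h2 := ENNReal.rpow_le_rpow
    (le_maximalFunction (volume.withDensity w) (fun y => h y ^ q) hx) P.conj.one_div_nonneg
  refine le_trans ?_ (mul_le_mul_right h2 _)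
  rw [ENNReal.div_rpow_of_nonneg _ _ P.conj.one_div_nonneg, ← mul_div_assoc,
    ENNReal.le_div_iff_mul_le (.inl (by simp [hw0, hwt])) (.inl (by simp [hw0, hwt])),
    ENNReal.div_eq_inv_mul, mul_assoc]
  rw [← ENNReal.mul_le_mul_iff_right (volume_ball_ne_zero c hr) (volume_ball_ne_top c r),
    ← mul_assoc, ENNReal.mul_inv_cancel (volume_ball_ne_zero c hr) (volume_ball_ne_top c r),
    one_mul]
  refine h1.trans_eq (by ring)

end IsMuckenhouptPair

/-- The pointwise bound `Mh ≤ A (M_w h^q)^{1/q}` reduces this to `M_w` on `L^{s/q}(w)`, where `s/q >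
1` and `w` is doubling. The endpoint `s = q` is out of reach this way. -/
theorem exists_lintegral_maximalFunction_rpow_le_of_lt (d : ℕ) {q q' s : ℝ} (A : ℝ≥0)
    (hqs : q < s) : ∃ C : ℝ≥0, ∀ w σ : EuclideanSpace ℝ (Fin d) → ℝ≥0∞,
      IsMuckenhouptPair q q' A w σ → ∀ h : EuclideanSpace ℝ (Fin d) → ℝ≥0∞, Measurable h →
        ∫⁻ x, maximalFunction volume h x ^ s ∂(volume.withDensity w) ≤
          C * ∫⁻ x, h x ^ s ∂(volume.withDensity w) := by
  -- For an inadmissible exponent there are no pairs, so any constant serves.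
  by_cases hq : 0 < q
  swap
  · exact ⟨0, fun w σ P => absurd P.conj.pos hq⟩
  have hs : 0 < s := hq.trans hqs
  let C : ℝ≥0∞ := (A : ℝ≥0∞) ^ s * (ENNReal.ofReal (s / q / (s / q - 1)) *
    (2 ^ (s / q) * ((A * 6 ^ d) ^ q : ℝ≥0)))
  have hC : C ≠ ∞ := by
    have : (A : ℝ≥0∞) ^ s ≠ ∞ := ENNReal.rpow_ne_top_of_nonneg hs.le (by simp)
    have : (2 : ℝ≥0∞) ^ (s / q) ≠ ∞ := ENNReal.rpow_ne_top_of_nonneg (by positivity) (by simp)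
    finiteness
  refine ⟨C.toNNReal, fun w σ P h hh => ?_⟩
  rw [ENNReal.coe_toNNReal hC]
  have h1 := P.isDoublingWith.lintegral_maximalFunction_rpow_le (hh.pow_const q)
    (s := s / q) ((one_lt_div hq).mpr hqs)
  simp_rw [← ENNReal.rpow_mul, mul_div_cancel₀ s hq.ne'] at h1
  calc _ ≤ ∫⁻ x, (A : ℝ≥0∞) ^ s * maximalFunction (volume.withDensity w) (fun y => h y ^ q) x ^
        (s / q) ∂(volume.withDensity w) := by
        refine lintegral_mono fun x => ?_
        refine (ENNReal.rpow_le_rpow (P.maximalFunction_le hh x) hs.le).trans_eq ?_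
        rw [ENNReal.mul_rpow_of_nonneg _ _ hs.le, ← ENNReal.rpow_mul, one_div_mul_eq_div]
    _ = (A : ℝ≥0∞) ^ s * ∫⁻ x, maximalFunction (volume.withDensity w) (fun y => h y ^ q) x ^
        (s / q) ∂(volume.withDensity w) := lintegral_const_mul' _ _
          (ENNReal.rpow_ne_top_of_nonneg hs.le (by simp))
    _ ≤ _ := by
        simp only [C]
        rw [mul_assoc]
        gcongr

namespace IsMuckenhouptPair

variable {d : ℕ} {q q' : ℝ} {A : ℝ≥0} {w σ : EuclideanSpace ℝ (Fin d) → ℝ≥0∞}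

/-- Lerner's pointwise bound of the maximal function by weighted maximal functions. -/
theorem maximalFunction_rpow_le (P : IsMuckenhouptPair q q' A w σ)
    (h : EuclideanSpace ℝ (Fin d) → ℝ≥0∞) (x : EuclideanSpace ℝ (Fin d)) :
    maximalFunction volume h x ^ (q - 1) ≤ (A : ℝ≥0∞) ^ q *
      maximalFunction (volume.withDensity w) (fun y => (w y)⁻¹ *
        maximalFunction (volume.withDensity σ) (fun z => (σ z)⁻¹ * h z) y ^ (q - 1)) x := by
  have hq1 : 0 < q - 1 := P.conj.sub_one_pos
  have hq0 : 0 < q := P.conj.pos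
  set F := maximalFunction (volume.withDensity σ) (fun z => (σ z)⁻¹ * h z)
  set G := maximalFunction (volume.withDensity w) (fun y => (w y)⁻¹ * F y ^ (q - 1))
  rw [← ENNReal.le_rpow_inv_iff hq1]
  refine iSup_le fun c => iSup_le fun r => iSup_le fun hx => ?_
  rw [ENNReal.le_rpow_inv_iff hq1]
  have hr : 0 < r := pos_of_mem_ball hx
  have hv0 := volume_ball_ne_zero c hr
  have hvt := volume_ball_ne_top c r
  have hw0 := P.withDensity_ball_ne_zero c hr
  have hwt := P.withDensity_ball_ne_top c r
  have hs0 := P.symm.withDensity_ball_ne_zero c hr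
  have hst := P.symm.withDensity_ball_ne_top c r
  have hle := P.le c r hr
  rw [← P.withDensity_ball, ← P.symm.withDensity_ball] at hle
  set W := volume.withDensity w (ball c r)
  set S := volume.withDensity σ (ball c r)
  set v := volume (ball c r)
  set I := ∫⁻ y in ball c r, h y
  -- `I / S` is the `σ`-average of `h / σ` over the ball, so `F ≥ I / S` there; then `F^{q-1} dx` is
  -- read as `(F^{q-1} / w) w dx`, whose `w`-average is at most `G x`.
  have h1 : (I / S) ^ (q - 1) * v ≤ W * G x := by
    have hI : I = ∫⁻ y in ball c r, (σ y)⁻¹ * h y ∂(volume.withDensity σ) := by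
      rw [P.symm.setLIntegral_withDensity measurableSet_ball]
      refine lintegral_congr fun y => ?_
      rw [← mul_assoc, ENNReal.mul_inv_cancel (P.symm.ne_zero y) (P.symm.ne_top y), one_mul]
    calc (I / S) ^ (q - 1) * v = ∫⁻ y in ball c r, (I / S) ^ (q - 1) := by
          rw [setLIntegral_const]
      _ ≤ ∫⁻ y in ball c r, F y ^ (q - 1) := by
          refine setLIntegral_mono' measurableSet_ball fun y hy => ?_
          refine ENNReal.rpow_le_rpow ?_ hq1.le
          rw [hI]
          exact le_maximalFunction _ _ hy
      _ = ∫⁻ y in ball c r, (w y)⁻¹ * F y ^ (q - 1) ∂(volume.withDensity w) := by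
          rw [P.setLIntegral_withDensity measurableSet_ball]
          refine lintegral_congr fun y => ?_
          rw [← mul_assoc, ENNReal.mul_inv_cancel (P.ne_zero y) (P.ne_top y), one_mul]
      _ ≤ W * G x := by
          rw [mul_comm, ← ENNReal.div_le_iff_le_mul (.inl hw0) (.inl hwt)]
          exact le_maximalFunction _ _ hx
  -- The `A_q` condition raised to the power `q`.
  have h2 : W * S ^ (q - 1) ≤ (A : ℝ≥0∞) ^ q * v ^ q := by
    have h := ENNReal.rpow_le_rpow hle hq0.le
    rwa [ENNReal.mul_rpow_of_nonneg _ _ hq0.le, ← ENNReal.rpow_mul, ← ENNReal.rpow_mul,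
      one_div_mul_cancel hq0.ne', ENNReal.rpow_one, one_div_mul_eq_div,
      P.conj.div_conj_eq_sub_one, ENNReal.mul_rpow_of_nonneg _ _ hq0.le] at h
  have hvq : v ^ q = v ^ (q - 1) * v := by
    conv_rhs => rw [← ENNReal.rpow_one v, ← ENNReal.rpow_mul]
    rw [← ENNReal.rpow_add _ _ hv0 hvt]
    ring_nf
  have hIS : I = I / S * S := (ENNReal.div_mul_cancel hs0 hst).symm
  rw [ENNReal.div_rpow_of_nonneg _ _ hq1.le, ENNReal.div_le_iff_le_mul
    (.inl (by simp [hv0, hvt])) (.inl (ENNReal.rpow_ne_top_of_nonneg hq1.le hvt)),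
    ← ENNReal.mul_le_mul_iff_left hv0 hvt]
  calc I ^ (q - 1) * v = ((I / S) ^ (q - 1) * v) * S ^ (q - 1) := by
        rw [hIS, ENNReal.mul_rpow_of_nonneg _ _ hq1.le, ← hIS]; ring
    _ ≤ W * G x * S ^ (q - 1) := by gcongr
    _ = (W * S ^ (q - 1)) * G x := by ring
    _ ≤ (A : ℝ≥0∞) ^ q * v ^ q * G x := by gcongr
    _ = _ := by rw [hvq]; ring

end IsMuckenhouptPair

/-- Muckenhoupt's theorem. -/
theorem exists_lintegral_maximalFunction_rpow_le (d : ℕ) (q q' : ℝ) (A : ℝ≥0) :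
    ∃ C : ℝ≥0, ∀ w σ : EuclideanSpace ℝ (Fin d) → ℝ≥0∞,
      IsMuckenhouptPair q q' A w σ → ∀ h : EuclideanSpace ℝ (Fin d) → ℝ≥0∞, Measurable h →
        ∫⁻ x, maximalFunction volume h x ^ q ∂(volume.withDensity w) ≤
          C * ∫⁻ x, h x ^ q ∂(volume.withDensity w) := by
  by_cases hc : q.HolderConjugate q'
  swap
  · exact ⟨0, fun w σ P => absurd P.conj hc⟩
  have hq : 1 < q := hc.lt
  have hq' : 1 < q' := hc.symm.lt
  -- Lerner's bound raised to the power `q'`, then the norm of `M_w` on `L^{q'}(w)` and of `M_σ` on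
  -- `L^q(σ)`.
  let C : ℝ≥0∞ := (A : ℝ≥0∞) ^ (q * q') *
    ((ENNReal.ofReal (q' / (q' - 1)) * (2 ^ q' * ((A * 6 ^ d) ^ q : ℝ≥0))) *
    (ENNReal.ofReal (q / (q - 1)) * (2 ^ q * ((A * 6 ^ d) ^ q' : ℝ≥0))))
  have hC : C ≠ ∞ := by
    have : (A : ℝ≥0∞) ^ (q * q') ≠ ∞ := ENNReal.rpow_ne_top_of_nonneg (by positivity) (by simp)
    have : (2 : ℝ≥0∞) ^ q' ≠ ∞ := ENNReal.rpow_ne_top_of_nonneg (by positivity) (by simp)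
    have : (2 : ℝ≥0∞) ^ q ≠ ∞ := ENNReal.rpow_ne_top_of_nonneg (by positivity) (by simp)
    finiteness
  refine ⟨C.toNNReal, fun w σ P h hh => ?_⟩
  rw [ENNReal.coe_toNNReal hC]
  have hw := P.measurable_left
  have hσ := P.measurable_right
  have hF : Measurable (maximalFunction (volume.withDensity σ) (fun z => (σ z)⁻¹ * h z)) :=
    measurable_maximalFunction _ _
  have hpoint := P.maximalFunction_rpow_le h
  have hSF := P.symm.isDoublingWith.lintegral_maximalFunction_rpow_le
    (h := fun z => (σ z)⁻¹ * h z) (by fun_prop) hq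
  set F := maximalFunction (volume.withDensity σ) (fun z => (σ z)⁻¹ * h z)
  have hSG := P.isDoublingWith.lintegral_maximalFunction_rpow_le
    (h := fun y => (w y)⁻¹ * F y ^ (q - 1)) (by fun_prop) hq'
  set G := maximalFunction (volume.withDensity w) (fun y => (w y)⁻¹ * F y ^ (q - 1))
  -- Since `w^{-q'} w = σ`, the inner function passes from `L^{q'}(w)` to `L^q(σ)`; the dual
  -- identity brings it back to `L^q(w)` in `e2`.
  have e1 : ∫⁻ y, ((w y)⁻¹ * F y ^ (q - 1)) ^ q' ∂(volume.withDensity w) =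
      ∫⁻ y, F y ^ q ∂(volume.withDensity σ) := by
    rw [P.lintegral_withDensity, P.symm.lintegral_withDensity]
    refine lintegral_congr fun y => ?_
    rw [ENNReal.mul_rpow_of_nonneg _ _ hc.symm.nonneg, ← ENNReal.rpow_mul, hc.sub_one_mul_conj,
      ← P.inv_rpow_mul y]
    ring
  have e2 : ∫⁻ y, ((σ y)⁻¹ * h y) ^ q ∂(volume.withDensity σ) =
      ∫⁻ y, h y ^ q ∂(volume.withDensity w) := by
    rw [P.lintegral_withDensity, P.symm.lintegral_withDensity]
    refine lintegral_congr fun y => ?_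
    rw [ENNReal.mul_rpow_of_nonneg _ _ hc.nonneg, ← P.symm.inv_rpow_mul y]
    ring
  rw [e1] at hSG
  rw [e2] at hSF
  calc _ ≤ ∫⁻ x, (A : ℝ≥0∞) ^ (q * q') * G x ^ q' ∂(volume.withDensity w) := by
        refine lintegral_mono fun x => ?_
        have := ENNReal.rpow_le_rpow (hpoint x) hc.symm.nonneg
        rwa [← ENNReal.rpow_mul, hc.sub_one_mul_conj, ENNReal.mul_rpow_of_nonneg _ _
          hc.symm.nonneg, ← ENNReal.rpow_mul] at this
    _ = (A : ℝ≥0∞) ^ (q * q') * ∫⁻ x, G x ^ q' ∂(volume.withDensity w) :=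
        lintegral_const_mul' _ _ (ENNReal.rpow_ne_top_of_nonneg (by positivity) (by simp))
    _ ≤ _ := by
        simp only [C]
        rw [mul_assoc, mul_assoc (ENNReal.ofReal (q' / (q' - 1)) * _)]
        gcongr
        refine hSG.trans ?_
        gcongr

/-! ### Stopping radii and the reverse weak-type estimate -/

section Stopping

variable {d : ℕ}

/-- Lebesgue differentiation along closed balls, whose boundary spheres are null. -/
theorem ae_exists_ball_mul_lt_setLIntegral {h : EuclideanSpace ℝ (Fin d) → ℝ≥0∞}
    (hh : Measurable h) (hfin : ∫⁻ x, h x ≠ ∞) :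
    ∀ᵐ x, ∀ a < h x, ∃ r, 0 < r ∧ a * volume (ball x r) < ∫⁻ y in ball x r, h y := by
  filter_upwards [(Besicovitch.vitaliFamily volume).ae_tendsto_lintegral_div hh.aemeasurable hfin]
    with x hx a ha
  have h1 := (hx.comp (Besicovitch.tendsto_filterAt volume x)).eventually (lt_mem_nhds ha)
  obtain ⟨r, hr, hr0⟩ := (h1.and self_mem_nhdsWithin).exists
  refine ⟨r, hr0, ?_⟩
  have hr' : 0 < r := hr0
  have e1 : ball x r =ᵐ[volume] closedBall x r := by
    refine ae_eq_of_subset_of_measure_ge ball_subset_closedBall ?_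
      measurableSet_ball.nullMeasurableSet measure_closedBall_lt_top.ne
    rw [Measure.addHaar_closedBall _ x hr'.le, Measure.addHaar_ball_of_pos _ x hr']
  rw [setLIntegral_congr e1, measure_congr e1]
  simp only [Function.comp_apply] at hr
  rwa [ENNReal.lt_div_iff_mul_lt] at hr
  · exact .inl (measure_closedBall_pos volume x hr').ne'
  · exact .inl measure_closedBall_lt_top.ne

theorem ae_le_maximalFunction {h : EuclideanSpace ℝ (Fin d) → ℝ≥0∞}
    (hh : Measurable h) (hfin : ∫⁻ x, h x ≠ ∞) : ∀ᵐ x, h x ≤ maximalFunction volume h x := by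
  filter_upwards [ae_exists_ball_mul_lt_setLIntegral hh hfin] with x hx
  refine le_of_forall_lt fun a ha => ?_
  obtain ⟨r, hr, h1⟩ := hx a ha
  refine lt_maximalFunction_iff.mpr ⟨x, r, mem_ball_self hr, ?_⟩
  rwa [ENNReal.lt_div_iff_mul_lt (.inl (volume_ball_ne_zero x hr)) (.inl (volume_ball_ne_top x r))]

/-- If some average of `h` around `x` exceeds `a`, there is an almost largest radius for which this
happens. -/
theorem exists_stopping_radius {h : EuclideanSpace ℝ (Fin d) → ℝ≥0∞} {a : ℝ≥0∞} {R : ℝ}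
    (hR : ∫⁻ x, h x ≤ a * volume (ball (0 : EuclideanSpace ℝ (Fin d)) R))
    {x : EuclideanSpace ℝ (Fin d)}
    (hx : ∃ ρ, 0 < ρ ∧ a * volume (ball x ρ) < ∫⁻ y in ball x ρ, h y) :
    ∃ r, 0 < r ∧ r < R ∧ a * volume (ball x r) < ∫⁻ y in ball x r, h y ∧
      ∀ ρ, 2 * r ≤ ρ → ∫⁻ y in ball x ρ, h y ≤ a * volume (ball x ρ) := by
  set S : Set ℝ := {ρ | 0 < ρ ∧ a * volume (ball x ρ) < ∫⁻ y in ball x ρ, h y}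
  have hlt : ∀ ρ ∈ S, ρ < R := by
    rintro ρ ⟨-, h1⟩
    by_contra! hcon
    refine absurd (h1.trans_le ((setLIntegral_le_lintegral _ _).trans hR)) (not_lt.mpr ?_)
    rw [← Measure.addHaar_ball_center volume x]
    gcongr
  have hbdd : BddAbove S := ⟨R, fun ρ hρ => (hlt ρ hρ).le⟩
  obtain ⟨ρ₀, hρ₀⟩ := hx
  have hpos : 0 < sSup S := hρ₀.1.trans_le (le_csSup hbdd hρ₀)
  -- A radius above half the supremum: anything beyond its double exceeds every admissible radius.
  obtain ⟨r, hr, hr2⟩ := exists_lt_of_lt_csSup ⟨ρ₀, hρ₀⟩ (half_lt_self hpos)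
  refine ⟨r, hr.1, hlt r hr, hr.2, fun ρ hρ => ?_⟩
  by_contra! hcon
  have : ρ ≤ sSup S := le_csSup hbdd ⟨by linarith [hr.1], hcon⟩
  linarith

/-- A reverse weak-type estimate for the maximal function, localized to a ball. -/
theorem setLIntegral_lt_le_measure_lt_maximalFunction {h : EuclideanSpace ℝ (Fin d) → ℝ≥0∞}
    (hh : Measurable h) {c : EuclideanSpace ℝ (Fin d)} {R : ℝ} {a : ℝ≥0∞} (ha : a ≠ ∞)
    (hB : ∫⁻ x in ball c R, h x ≤ a * volume (ball c R)) :
    ∫⁻ x in ball c R ∩ {x | a < h x}, h x ≤ 6 ^ d * (a * volume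
      ({x | a < maximalFunction volume ((ball c R).indicator h) x} ∩ ball c (2 * R))) := by
  set k := (ball c R).indicator h with hk
  have hkm : Measurable k := hh.indicator measurableSet_ball
  have hkint : ∫⁻ x, k x = ∫⁻ x in ball c R, h x := lintegral_indicator measurableSet_ball _
  have hkR : ∫⁻ x, k x ≤ a * volume (ball (0 : EuclideanSpace ℝ (Fin d)) R) := by
    rw [hkint, ← Measure.addHaar_ball_center volume c]; exact hB
  have hkfin : ∫⁻ x, k x ≠ ∞ :=
    (hkR.trans_lt (ENNReal.mul_lt_top ha.lt_top (volume_ball_ne_top _ _).lt_top)).ne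
  set t : Set (EuclideanSpace ℝ (Fin d)) :=
    -- By differentiation this contains almost every point of the ball where `h > a`.
    {x | x ∈ ball c R ∧ ∃ ρ, 0 < ρ ∧ a * volume (ball x ρ) < ∫⁻ y in ball x ρ, k y}
  have hrad : ∀ x : EuclideanSpace ℝ (Fin d), ∃ r, x ∈ t → 0 < r ∧ r < R ∧
      a * volume (ball x r) < ∫⁻ y in ball x r, k y ∧
      ∀ ρ, 2 * r ≤ ρ → ∫⁻ y in ball x ρ, k y ≤ a * volume (ball x ρ) := by
    intro x
    by_cases hx : x ∈ t
    · obtain ⟨r, hr⟩ := exists_stopping_radius hkR hx.2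
      exact ⟨r, fun _ => hr⟩
    · exact ⟨0, fun h => absurd h hx⟩
  choose r hr using hrad
  obtain ⟨u, hut, hu, hd, hcov⟩ := exists_countable_disjoint_balls_covering t id r R
    (fun x hx => (hr x hx).1) (fun x hx => (hr x hx).2.1.le)
  simp only [id_eq] at hd hcov
  have hsub : (ball c R ∩ {x | a < h x} : Set _) ≤ᵐ[volume]
      (⋃ b ∈ u, ball b (6 * r b) : Set _) := by
    filter_upwards [ae_exists_ball_mul_lt_setLIntegral hkm hkfin] with x hx hxs
    have hkx : k x = h x := indicator_of_mem hxs.1 _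
    have hxt : x ∈ t := ⟨hxs.1, hx a (by rw [hkx]; exact hxs.2)⟩
    obtain ⟨b, hb, hb'⟩ := hcov x hxt
    exact mem_biUnion hb (hb' (mem_ball_self (hr x hxt).1))
  have hsub2 : (⋃ b ∈ u, ball b (r b)) ⊆ {x | a < maximalFunction volume k x} ∩ ball c (2 * R) := by
    refine iUnion₂_subset fun b hb y hy => ⟨?_, ?_⟩
    · obtain ⟨h1, -, h2, -⟩ := hr b (hut hb)
      refine lt_maximalFunction_iff.mpr ⟨b, r b, hy, ?_⟩
      rwa [ENNReal.lt_div_iff_mul_lt (.inl (volume_ball_ne_zero b h1))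
        (.inl (volume_ball_ne_top b _))]
    · have h1 := (hr b (hut hb)).2.1
      have h2 : dist b c < R := (hut hb).1
      have h3 : dist y b < r b := hy
      have := dist_triangle y b c
      exact mem_ball.mpr (by linarith)
  calc ∫⁻ x in ball c R ∩ {x | a < h x}, h x = ∫⁻ x in ball c R ∩ {x | a < h x}, k x :=
        setLIntegral_congr_fun (measurableSet_ball.inter (measurableSet_lt measurable_const hh))
          fun x hx => (indicator_of_mem hx.1 _).symm
    _ ≤ ∫⁻ x in ⋃ b ∈ u, ball b (6 * r b), k x := lintegral_mono_set' hsub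
    _ ≤ ∑' b : u, ∫⁻ x in ball b.1 (6 * r b), k x := by
        have := hu.to_subtype
        rw [biUnion_eq_iUnion]
        exact lintegral_iUnion_le _ _
    _ ≤ ∑' b : u, 6 ^ d * (a * volume (ball b.1 (r b))) := by
        refine ENNReal.tsum_le_tsum fun b => ?_
        obtain ⟨h1, -, -, h2⟩ := hr b.1 (hut b.2)
        -- The enlarged radius `6r` is at least `2r`, so the average over the enlarged ball is at
        -- most `a` by the choice of `r`.
        refine (h2 _ (by linarith)).trans_eq ?_
        rw [volume_ball_mul b.1 b.1 (by norm_num), ENNReal.ofReal_pow (by norm_num)]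
        simp only [ENNReal.ofReal_ofNat]
        ring
    _ = 6 ^ d * (a * volume (⋃ b ∈ u, ball b (r b))) := by
        rw [ENNReal.tsum_mul_left, ENNReal.tsum_mul_left,
          measure_biUnion hu hd fun _ _ => measurableSet_ball]
    _ ≤ _ := by gcongr

end Stopping

/-! ### The `A_∞` property -/

/-- A geometric sum of ratio two is at most twice its last term. It allows reverse weak-type
estimates to be summed over dyadic levels. -/
theorem sum_two_pow_mul_ite_lt_le (m b : ℝ≥0∞) (n : ℕ) :
    ∑ k ∈ Finset.range n, (if 2 ^ k * m < b then 2 ^ k * m else 0) ≤ 2 * b := by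
  induction n with
  | zero => simp
  | succ n ih =>
    rw [Finset.sum_range_succ]
    split_ifs with hn
    · have h1 : ∀ j : ℕ, ∑ k ∈ Finset.range j, (if 2 ^ k * m < b then 2 ^ k * m else 0) ≤
          2 ^ j * m := by
        intro j
        induction j with
        | zero => simp
        | succ j ihj =>
          rw [Finset.sum_range_succ, pow_succ, mul_comm (2 ^ j) 2, mul_assoc, two_mul]
          refine add_le_add ihj ?_
          split_ifs
          · exact le_rfl
          · exact zero_le
      calc _ ≤ 2 ^ n * m + 2 ^ n * m := by gcongr; exact h1 n
        _ ≤ b + b := by gcongr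
        _ = 2 * b := (two_mul b).symm
    · simpa using ih

namespace IsMuckenhouptPair

variable {d : ℕ} {q q' : ℝ} {A : ℝ≥0} {w σ : EuclideanSpace ℝ (Fin d) → ℝ≥0∞}

/-- Hölder between `L^{q'}(σ)` and `L^q(w)`, with `M` bounded on `L^{q'}(σ)` by duality and `∫_B
w^{q'} σ = w(B)`. It is an `L log L` type bound for `w`, and replaces the reverse Hölder inequality
in the proof of `A_∞`. -/
theorem setLIntegral_maximalFunction_le (P : IsMuckenhouptPair q q' A w σ) {C : ℝ≥0}
    (hC : ∀ h : EuclideanSpace ℝ (Fin d) → ℝ≥0∞, Measurable h →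
      ∫⁻ x, maximalFunction volume h x ^ q' ∂(volume.withDensity σ) ≤
        C * ∫⁻ x, h x ^ q' ∂(volume.withDensity σ))
    (c : EuclideanSpace ℝ (Fin d)) {R : ℝ} (hR : 0 < R) :
    ∫⁻ x in ball c (2 * R), maximalFunction volume ((ball c R).indicator w) x ≤
      (C : ℝ≥0∞) ^ (1 / q') * (A * 2 ^ d) * volume.withDensity w (ball c R) := by
  set k := (ball c R).indicator w with hk
  have hkm : Measurable k := P.measurable_left.indicator measurableSet_ball
  set W := volume.withDensity w (ball c R)
  have hW0 : W ≠ 0 := P.withDensity_ball_ne_zero c hR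
  have hWt : W ≠ ∞ := P.withDensity_ball_ne_top c R
  have hq := P.conj.pos
  have hq' := P.conj.symm.pos
  have h1 : ∫⁻ x, k x ^ q' ∂(volume.withDensity σ) = W := by
    simp only [W]
    rw [P.symm.lintegral_withDensity, P.withDensity_ball, ← lintegral_indicator measurableSet_ball]
    refine lintegral_congr fun x => ?_
    by_cases hx : x ∈ ball c R
    · rw [hk, indicator_of_mem hx]
      calc σ x * w x ^ q' = (w x ^ (q' - 1) * σ x) * w x := by
            rw [show q' = (q' - 1) + 1 by ring, ENNReal.rpow_add _ _ (P.ne_zero x) (P.ne_top x),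
              ENNReal.rpow_one]; ring_nf
        _ = w x := by rw [P.rpow_mul, one_mul]
    · rw [hk, indicator_of_notMem hx, ENNReal.zero_rpow_of_pos hq',
        mul_zero]
  have h2 : (∫⁻ x in ball c (2 * R), w x) ^ (1 / q) ≤ A * 2 ^ d * W ^ (1 / q) := by
    rw [← P.withDensity_ball]
    have h := P.withDensity_ball_mul_le (c := c) (c' := c) (a := 2) (by norm_num) hR
      (ball_subset_ball (by linarith))
    have h' := ENNReal.rpow_le_rpow h (z := 1 / q) (by positivity)
    rw [ENNReal.mul_rpow_of_nonneg _ _ (by positivity), ← ENNReal.rpow_mul,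
      mul_one_div_cancel hq.ne', ENNReal.rpow_one, ENNReal.ofReal_pow (by norm_num)] at h'
    simpa using h'
  calc _ ≤ (∫⁻ x in ball c (2 * R), maximalFunction volume k x ^ q' ∂(volume.withDensity σ)) ^
        (1 / q') * (∫⁻ x in ball c (2 * R), w x) ^ (1 / q) :=
        P.symm.setLIntegral_le (measurable_maximalFunction _ _) measurableSet_ball
    _ ≤ (C * W) ^ (1 / q') * (A * 2 ^ d * W ^ (1 / q)) := by
        gcongr
        rw [← h1]
        exact (setLIntegral_le_lintegral _ _).trans (hC k hkm)
    _ = (C : ℝ≥0∞) ^ (1 / q') * (A * 2 ^ d) * W ^ (1 / q' + 1 / q) := by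
        rw [ENNReal.mul_rpow_of_nonneg _ _ (by positivity), ENNReal.rpow_add _ _ hW0 hWt]
        ring
    _ = _ := by
        rw [one_div, one_div, P.conj.symm.inv_add_inv_eq_one, ENNReal.rpow_one]

end IsMuckenhouptPair

/-- The `A_∞` property of Muckenhoupt weights: subsets of a ball of small relative Lebesgue measure
have small relative weight. -/
theorem exists_withDensity_le_of_volume_le (d : ℕ) (q q' : ℝ) (A : ℝ≥0) {η : ℝ≥0} (hη : 0 < η) :
    ∃ ε : ℝ≥0, 0 < ε ∧ ∀ w σ : EuclideanSpace ℝ (Fin d) → ℝ≥0∞, IsMuckenhouptPair q q' A w σ →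
      ∀ (c : EuclideanSpace ℝ (Fin d)) (R : ℝ), 0 < R → ∀ s ⊆ ball c R, MeasurableSet s →
        volume s ≤ ε * volume (ball c R) →
          volume.withDensity w s ≤ η * volume.withDensity w (ball c R) := by
  by_cases hc : q.HolderConjugate q'
  swap
  · exact ⟨1, one_pos, fun w σ P => absurd P.conj hc⟩
  obtain ⟨C, hC⟩ := exists_lintegral_maximalFunction_rpow_le d q' q A
  have hq' : 0 < q' := hc.symm.pos
  set C₂ : ℝ≥0 := 6 ^ d * (2 * (C ^ (1 / q') * (A * 2 ^ d)))
  -- Ensures `C₂ / n ≤ η / 2`, for the part where `w > 2^n m`, with `m` the average of `w` over the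
  -- ball. Where `w ≤ 2^n m`, the choice `ε = (η / 2) / 2^n` bounds the weight by `2^n m ε |B| = (η
  -- / 2) w(B)`.
  obtain ⟨n, hn⟩ := exists_nat_ge (C₂ / (η / 2) + 1)
  have hη2 : 0 < η / 2 := half_pos hη
  have hn0 : (0 : ℝ≥0) < n := lt_of_lt_of_le (by positivity) hn
  refine ⟨η / 2 / 2 ^ n, by positivity, fun w σ P c R hR s hs hsm hsv => ?_⟩
  have hw := P.measurable_left
  set k := (ball c R).indicator w
  set W := volume.withDensity w (ball c R)
  have hv0 := volume_ball_ne_zero c hR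
  have hvt := volume_ball_ne_top c R
  have hWt : W ≠ ∞ := P.withDensity_ball_ne_top c R
  set m := W / volume (ball c R)
  have hmv : m * volume (ball c R) = W := ENNReal.div_mul_cancel hv0 hvt
  have hmt : m ≠ ∞ := ENNReal.div_ne_top hWt hv0
  have hM := P.setLIntegral_maximalFunction_le (hC σ w P.symm) c hR
  have hmeas : ∀ a : ℝ≥0∞, MeasurableSet (ball c R ∩ {x | a < w x}) := fun a =>
    measurableSet_ball.inter (measurableSet_lt measurable_const hw)
  have hrev : ∀ j : ℕ, volume.withDensity w (ball c R ∩ {x | 2 ^ j * m < w x}) ≤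
      6 ^ d * ∫⁻ x in ball c (2 * R),
        (if 2 ^ j * m < maximalFunction volume k x then 2 ^ j * m else 0) := by
    intro j
    rw [withDensity_apply _ (hmeas _)]
    refine (setLIntegral_lt_le_measure_lt_maximalFunction hw (a := 2 ^ j * m)
      (by finiteness) ?_).trans_eq ?_
    · rw [← P.withDensity_ball]
      calc W = m * volume (ball c R) := hmv.symm
        _ ≤ _ := by
          gcongr
          exact le_mul_of_one_le_left (by simp) (one_le_pow₀ (by norm_num))
    · congr 1
      have ho : MeasurableSet {x | 2 ^ j * m < maximalFunction volume k x} :=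
        (isOpen_lt_maximalFunction _ _ _).measurableSet
      rw [← Measure.restrict_apply ho, ← lintegral_indicator_const ho]
      simp only [indicator, mem_ofPred_eq]
  -- The top level set lies in each of the `n` lower ones, while the dyadic sum stays below `2 Mk`;
  -- this gains the factor `1 / n`.
  have hsum : (n : ℝ≥0∞) * volume.withDensity w (ball c R ∩ {x | 2 ^ n * m < w x}) ≤ C₂ * W := by
    calc (n : ℝ≥0∞) * volume.withDensity w (ball c R ∩ {x | 2 ^ n * m < w x}) =
          ∑ j ∈ Finset.range n, volume.withDensity w (ball c R ∩ {x | 2 ^ n * m < w x}) := by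
          simp
      _ ≤ ∑ j ∈ Finset.range n, 6 ^ d * ∫⁻ x in ball c (2 * R),
          (if 2 ^ j * m < maximalFunction volume k x then 2 ^ j * m else 0) := by
          refine Finset.sum_le_sum fun j hj => le_trans (measure_mono ?_) (hrev j)
          rintro x ⟨hx1, hx2⟩
          refine ⟨hx1, show 2 ^ j * m < w x from lt_of_le_of_lt ?_ hx2⟩
          gcongr
          · norm_num
          · exact (Finset.mem_range.mp hj).le
      _ = 6 ^ d * ∫⁻ x in ball c (2 * R), ∑ j ∈ Finset.range n,
          (if 2 ^ j * m < maximalFunction volume k x then 2 ^ j * m else 0) := by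
          rw [← Finset.mul_sum, lintegral_finsetSum]
          exact fun j _ => Measurable.ite (isOpen_lt_maximalFunction _ _ _).measurableSet
            measurable_const measurable_const
      _ ≤ 6 ^ d * ∫⁻ x in ball c (2 * R), 2 * maximalFunction volume k x := by
          gcongr
          exact sum_two_pow_mul_ite_lt_le _ _ _
      _ = 6 ^ d * (2 * ∫⁻ x in ball c (2 * R), maximalFunction volume k x) := by
          rw [lintegral_const_mul' _ _ (by simp)]
      _ ≤ 6 ^ d * (2 * ((C : ℝ≥0∞) ^ (1 / q') * (A * 2 ^ d) * W)) := by gcongr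
      _ = C₂ * W := by
          simp only [C₂]
          push_cast
          rw [ENNReal.coe_rpow_of_nonneg _ (by positivity)]
          ring
  have hhigh : volume.withDensity w (ball c R ∩ {x | 2 ^ n * m < w x}) ≤ (η / 2 : ℝ≥0) * W := by
    have hn0' : (n : ℝ≥0∞) ≠ 0 := by exact_mod_cast hn0.ne'
    rw [← ENNReal.mul_le_mul_iff_right hn0' (by simp), ← mul_assoc]
    refine hsum.trans ?_
    gcongr
    have h1 : C₂ ≤ n * (η / 2) := by
      rw [← div_le_iff₀ hη2]
      exact le_trans (le_add_of_nonneg_right zero_le_one) hn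
    exact_mod_cast h1
  have hlow : volume.withDensity w (s \ {x | 2 ^ n * m < w x}) ≤ (η / 2 : ℝ≥0) * W := by
    have hm' : MeasurableSet (s \ {x | 2 ^ n * m < w x}) :=
      hsm.diff (measurableSet_lt measurable_const hw)
    rw [withDensity_apply _ hm']
    calc _ ≤ ∫⁻ x in s \ {x | 2 ^ n * m < w x}, 2 ^ n * m :=
          setLIntegral_mono' hm' fun x hx => not_lt.mp hx.2
      _ = 2 ^ n * m * volume (s \ {x | 2 ^ n * m < w x}) := setLIntegral_const _ _
      _ ≤ 2 ^ n * m * ((η / 2 / 2 ^ n : ℝ≥0) * volume (ball c R)) := by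
          gcongr
          exact (measure_mono sdiff_subset).trans hsv
      _ = (2 ^ n * (η / 2 / 2 ^ n : ℝ≥0)) * (m * volume (ball c R)) := by ring
      _ = (η / 2 : ℝ≥0) * W := by
          rw [hmv]
          congr 1
          have : (2 : ℝ≥0) ^ n * (η / 2 / 2 ^ n) = η / 2 := by field_simp
          exact_mod_cast this
  calc volume.withDensity w s ≤ volume.withDensity w
        ((ball c R ∩ {x | 2 ^ n * m < w x}) ∪ (s \ {x | 2 ^ n * m < w x})) := by
        refine measure_mono fun x hx => ?_
        by_cases hxw : 2 ^ n * m < w x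
        · exact .inl ⟨hs hx, hxw⟩
        · exact .inr ⟨hx, hxw⟩
    _ ≤ (η / 2 : ℝ≥0) * W + (η / 2 : ℝ≥0) * W := (measure_union_le _ _).trans (by gcongr)
    _ = η * W := by
        rw [← add_mul, ← ENNReal.coe_add, add_halves]

/-! ### Growth of Muckenhoupt weights at infinity -/

namespace IsMuckenhouptPair

variable {d : ℕ} {q q' : ℝ} {A : ℝ≥0} {w σ : EuclideanSpace ℝ (Fin d) → ℝ≥0∞}

/-- For `d ≥ 1` the annulus `B(0, 2n) \ B(0, n)` has at least the volume of `B(0, n)`, so by `A_q`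
it carries a fixed proportion of `w(B(0, 2n))`. Finite total mass would force the weight outside
`B(0, n)`, hence `w(B(0, 1))`, to vanish. -/
theorem withDensity_univ (P : IsMuckenhouptPair q q' A w σ) (hd : 1 ≤ d) :
    volume.withDensity w univ = ∞ := by
  by_contra htop
  set μ := volume.withDensity w
  have hq := P.conj.pos
  have hfin : ∀ s, μ s ≠ ∞ := fun s => ((measure_mono (subset_univ s)).trans_lt
    (lt_top_iff_ne_top.mpr htop)).ne
  have hlim : Tendsto (fun n : ℕ => μ (ball (0 : EuclideanSpace ℝ (Fin d)) n)ᶜ) atTop (𝓝 0) := by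
    have h := tendsto_measure_iInter_atTop (μ := μ)
      (s := fun n : ℕ => (ball (0 : EuclideanSpace ℝ (Fin d)) n)ᶜ)
      (fun n => measurableSet_ball.compl.nullMeasurableSet)
      (fun m n hmn => compl_subset_compl.mpr (ball_subset_ball (by exact_mod_cast hmn)))
      ⟨0, hfin _⟩
    rwa [← compl_iUnion, iUnion_ball_nat, compl_univ, measure_empty] at h
  have hbound : ∀ n : ℕ, 1 ≤ n → μ (ball 0 1) ≤ ((A : ℝ≥0∞) * 2 ^ d) ^ q *
      μ (ball (0 : EuclideanSpace ℝ (Fin d)) n)ᶜ := by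
    intro n hn
    have hn' : (1 : ℝ) ≤ n := by exact_mod_cast hn
    set B := ball (0 : EuclideanSpace ℝ (Fin d)) n
    set B₂ := ball (0 : EuclideanSpace ℝ (Fin d)) (2 * n)
    have hB0 : volume B ≠ 0 := volume_ball_ne_zero _ (by linarith)
    have hBt : volume B ≠ ∞ := volume_ball_ne_top _ _
    have hvB₂ : volume B₂ = 2 ^ d * volume B := by
      simp only [B₂, B]
      rw [volume_ball_mul _ 0 (by norm_num), ENNReal.ofReal_pow (by norm_num)]
      simp
    have hBsub : B ⊆ B₂ := ball_subset_ball (by linarith)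
    have hdiff : volume B ≤ volume (B₂ \ B) := by
      rw [measure_sdiff hBsub measurableSet_ball.nullMeasurableSet hBt, hvB₂]
      refine ENNReal.le_sub_of_add_le_left hBt ?_
      rw [← two_mul]
      gcongr
      exact le_self_pow₀ (by norm_num) (by omega)
    have h1 := P.volume_mul_rpow_le (s := B₂ \ B) (c := 0) (r := 2 * n)
      (measurableSet_ball.diff measurableSet_ball) (by linarith) sdiff_subset
    have h2 : μ B₂ ^ (1 / q) ≤ A * 2 ^ d * μ Bᶜ ^ (1 / q) := by
      rw [← ENNReal.mul_le_mul_iff_right hB0 hBt]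
      calc _ ≤ volume (B₂ \ B) * μ B₂ ^ (1 / q) := by gcongr
        _ ≤ A * volume B₂ * μ (B₂ \ B) ^ (1 / q) := h1
        _ ≤ A * (2 ^ d * volume B) * μ Bᶜ ^ (1 / q) := by
          rw [hvB₂]
          gcongr
          exact sdiff_subset_compl _ _
        _ = _ := by ring
    have h3 := ENNReal.rpow_le_rpow h2 hq.le
    rw [ENNReal.mul_rpow_of_nonneg _ _ hq.le, ← ENNReal.rpow_mul, ← ENNReal.rpow_mul,
      one_div_mul_cancel hq.ne', ENNReal.rpow_one, ENNReal.rpow_one] at h3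
    exact (measure_mono (ball_subset_ball (by linarith))).trans h3
  have hCt : ((A : ℝ≥0∞) * 2 ^ d) ^ q ≠ ∞ := ENNReal.rpow_ne_top_of_nonneg hq.le (by finiteness)
  have hlim2 := ENNReal.Tendsto.const_mul hlim (.inr hCt)
  rw [mul_zero] at hlim2
  have := ge_of_tendsto hlim2 (eventually_atTop.mpr ⟨1, hbound⟩)
  exact P.withDensity_ball_ne_zero 0 one_pos (le_zero_iff.mp this)

/-- By `A_q` the quotient is at most `A^q σ(B)^{1-q}`, and the dual weight `σ` also has infinite
total mass. -/
theorem tendsto_withDensity_ball_div (P : IsMuckenhouptPair q q' A w σ) (hd : 1 ≤ d) :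
    Tendsto (fun n : ℕ => volume.withDensity w (ball (0 : EuclideanSpace ℝ (Fin d)) n) /
      volume (ball (0 : EuclideanSpace ℝ (Fin d)) n) ^ q) atTop (𝓝 0) := by
  have hq := P.conj.pos
  have hq1 := P.conj.sub_one_pos
  have hσ : Tendsto (fun n : ℕ => volume.withDensity σ (ball (0 : EuclideanSpace ℝ (Fin d)) n))
      atTop (𝓝 ∞) := by
    have h := tendsto_measure_iUnion_atTop (μ := volume.withDensity σ)
      (s := fun n : ℕ => ball (0 : EuclideanSpace ℝ (Fin d)) n)
      (fun m n hmn => ball_subset_ball (by exact_mod_cast hmn))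
    rwa [iUnion_ball_nat, P.symm.withDensity_univ hd] at h
  have hlim : Tendsto (fun n : ℕ => (A : ℝ≥0∞) ^ q *
      (volume.withDensity σ (ball (0 : EuclideanSpace ℝ (Fin d)) n) ^ (q - 1))⁻¹) atTop (𝓝 0) := by
    have h1 := (ENNReal.continuous_rpow_const (y := q - 1)).tendsto ∞ |>.comp hσ
    rw [ENNReal.top_rpow_of_pos hq1] at h1
    have h2 := (tendsto_inv_iff.mpr h1)
    rw [ENNReal.inv_top] at h2
    have h3 := ENNReal.Tendsto.const_mul h2 (a := (A : ℝ≥0∞) ^ q)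
      (.inr (ENNReal.rpow_ne_top_of_nonneg hq.le (by simp)))
    rwa [mul_zero] at h3
  refine tendsto_of_tendsto_of_tendsto_of_le_of_le' tendsto_const_nhds hlim
    (Eventually.of_forall fun _ => zero_le) (eventually_atTop.mpr ⟨1, fun n hn => ?_⟩)
  have hr : (0 : ℝ) < n := by exact_mod_cast hn
  have h := P.le 0 n hr
  rw [← P.withDensity_ball, ← P.symm.withDensity_ball] at h
  have hv0 := volume_ball_ne_zero (0 : EuclideanSpace ℝ (Fin d)) hr
  have hvt := volume_ball_ne_top (0 : EuclideanSpace ℝ (Fin d)) n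
  have hs0 := P.symm.withDensity_ball_ne_zero 0 hr
  have hst := P.symm.withDensity_ball_ne_top 0 n
  have h' := ENNReal.rpow_le_rpow h hq.le
  rw [ENNReal.mul_rpow_of_nonneg _ _ hq.le, ← ENNReal.rpow_mul, ← ENNReal.rpow_mul,
    one_div_mul_cancel hq.ne', ENNReal.rpow_one, one_div_mul_eq_div,
    P.conj.div_conj_eq_sub_one, ENNReal.mul_rpow_of_nonneg _ _ hq.le] at h'
  rw [ENNReal.div_le_iff (by simp [hv0, hvt]) (ENNReal.rpow_ne_top_of_nonneg hq.le hvt),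
    mul_right_comm, ← div_eq_mul_inv,
    ENNReal.le_div_iff_mul_le (.inl (by simp [hs0, hst]))
      (.inl (ENNReal.rpow_ne_top_of_nonneg hq1.le hst))]
  exact h'

end IsMuckenhouptPair

/-! ### The good-`λ` argument -/

/-- Absorption step of the good-`λ` method. -/
theorem lintegral_rpow_le_of_good_lambda {α : Type*} [MeasurableSpace α] {μ : Measure α}
    [IsFiniteMeasure μ] {H G : α → ℝ≥0∞} (hH : Measurable H) (hG : Measurable G) {q : ℝ}
    (hq : 0 < q) {β γ δ : ℝ≥0} (hβ : 1 ≤ β) (hγ : 0 < γ) (hδ : β ^ q * δ ≤ 1 / 2) {a : ℝ≥0∞}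
    (hgood : ∀ t : ℝ≥0∞, t ≠ 0 → t ≠ ∞ → a ≤ t →
      μ {x | β * t < H x} ≤ δ * μ {x | t < H x} + μ {x | γ * t < G x}) :
    ∫⁻ x, H x ^ q ∂μ ≤ 2 * ((β : ℝ≥0∞) ^ q *
      (a ^ q * μ univ + (γ : ℝ≥0∞)⁻¹ ^ q * ∫⁻ x, G x ^ q ∂μ)) := by
  have hβ0 : (β : ℝ≥0∞) ≠ 0 := by exact_mod_cast (one_pos.trans_le hβ).ne'
  have hβ1 : (1 : ℝ≥0∞) ≤ β := by exact_mod_cast hβ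
  have hγ0 : (γ : ℝ≥0∞) ≠ 0 := by exact_mod_cast hγ.ne'
  have hδ' : (β : ℝ≥0∞) ^ q * δ ≤ 1 / 2 := by
    rw [← ENNReal.coe_rpow_of_nonneg _ hq.le]
    have := ENNReal.coe_le_coe.mpr hδ
    push_cast at this
    simpa using this
  set Y := (β : ℝ≥0∞) ^ q * (a ^ q * μ univ + (γ : ℝ≥0∞)⁻¹ ^ q * ∫⁻ x, G x ^ q ∂μ)
  -- Truncation makes the integral finite, so that half of it can be subtracted.
  have trunc : ∀ n : ℕ, ∫⁻ x, (min (H x) n) ^ q ∂μ ≤ 2 * Y := by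
    intro n
    set X := ∫⁻ x, (min (H x) n) ^ q ∂μ with hX
    have hXt : X ≠ ∞ := by
      have : X ≤ ∫⁻ _, (n : ℝ≥0∞) ^ q ∂μ :=
        lintegral_mono fun x => ENNReal.rpow_le_rpow (min_le_right _ _) hq.le
      rw [lintegral_const] at this
      refine (this.trans_lt (ENNReal.mul_lt_top ?_ (measure_lt_top _ _))).ne
      exact (ENNReal.rpow_ne_top_of_nonneg hq.le (by simp)).lt_top
    -- Compared level by level: below `a` the constant term covers everything, between `a` and `n`
    -- the hypothesis applies, and from `n` on the left side is empty.
    have h1 : ∫⁻ x, (min (H x / β) n) ^ q ∂μ ≤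
        a ^ q * μ univ + δ * X + (γ : ℝ≥0∞)⁻¹ ^ q * ∫⁻ x, G x ^ q ∂μ := by
      have e1 : a ^ q * μ univ = ∫⁻ _, a ^ q ∂μ := (lintegral_const _).symm
      have e2 : (γ : ℝ≥0∞)⁻¹ ^ q * ∫⁻ x, G x ^ q ∂μ = ∫⁻ x, (G x / γ) ^ q ∂μ := by
        rw [← lintegral_const_mul' _ _ (ENNReal.rpow_ne_top_of_nonneg hq.le (by simp [hγ0]))]
        refine lintegral_congr fun x => ?_
        rw [← ENNReal.mul_rpow_of_nonneg _ _ hq.le, ENNReal.div_eq_inv_mul]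
      rw [e1, e2, hX, lintegral_rpow_eq_lintegral_meas_lt μ (by fun_prop) hq,
        lintegral_rpow_eq_lintegral_meas_lt μ (u := fun _ => a) (by fun_prop) hq,
        lintegral_rpow_eq_lintegral_meas_lt μ (u := fun x => min (H x) n) (by fun_prop) hq,
        lintegral_rpow_eq_lintegral_meas_lt μ (u := fun x => G x / γ) (by fun_prop) hq,
        mul_left_comm, ← mul_add, ← mul_add, ← lintegral_const_mul' (δ : ℝ≥0∞) _ (by simp)]
      refine mul_le_mul' le_rfl ?_
      have hmeas : ∀ u : α → ℝ≥0∞, Measurable (fun t : ℝ =>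
          μ {x | ENNReal.ofReal t < u x} * ENNReal.ofReal (t ^ (q - 1))) := by
        intro u
        refine Measurable.mul ?_ (by fun_prop)
        refine Antitone.measurable fun t t' htt => measure_mono fun x hx => ?_
        exact lt_of_le_of_lt (ENNReal.ofReal_le_ofReal htt) hx
      rw [← lintegral_add_right _ ((hmeas fun x => min (H x) n).const_mul _),
        ← lintegral_add_right _ (hmeas fun x => G x / γ)]
      refine setLIntegral_mono' measurableSet_Ioi fun t ht => ?_
      rw [← mul_assoc, ← add_mul, ← add_mul]
      refine mul_le_mul' ?_ le_rfl
      have ht0 : ENNReal.ofReal t ≠ 0 := by simpa using ht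
      set τ := ENNReal.ofReal t
      have hτt : τ ≠ ∞ := ENNReal.ofReal_ne_top
      rcases lt_or_ge τ a with hta | hta
      · have : {x : α | τ < a} = univ := by ext; simp [hta]
        rw [this, add_assoc]
        exact (measure_mono (subset_univ _)).trans le_self_add
      · rcases lt_or_ge τ (n : ℝ≥0∞) with htn | htn
        · have h2 := hgood τ ht0 hτt hta
          have s1 : {x | τ < min (H x / β) n} = {x | β * τ < H x} := by
            ext x
            simp [htn, ENNReal.lt_div_iff_mul_lt, hβ0, mul_comm]
          have s2 : {x | τ < min (H x) n} = {x | τ < H x} := by ext x; simp [htn]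
          have s3 : {x | τ < G x / γ} = {x | γ * τ < G x} := by
            ext x
            simp [ENNReal.lt_div_iff_mul_lt, hγ0, mul_comm]
          rw [s1, s2, s3, add_assoc]
          exact h2.trans le_add_self
        · have : {x | τ < min (H x / β) n} = ∅ := by
            ext x
            simp only [mem_ofPred_eq, mem_empty_iff_false, iff_false, not_lt]
            exact (min_le_right _ _).trans htn
          rw [this, measure_empty]
          exact zero_le
    -- As `β ≥ 1`, `min H n ≤ β min (H / β) n`.
    have h2 : X ≤ (β : ℝ≥0∞) ^ q * ∫⁻ x, (min (H x / β) n) ^ q ∂μ := by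
      rw [← lintegral_const_mul' _ _ (ENNReal.rpow_ne_top_of_nonneg hq.le (by simp))]
      refine lintegral_mono fun x => ?_
      rw [← ENNReal.mul_rpow_of_nonneg _ _ hq.le]
      refine ENNReal.rpow_le_rpow ?_ hq.le
      rcases le_total (H x / β) (n : ℝ≥0∞) with h | h
      · rw [min_eq_left h, ENNReal.mul_div_cancel hβ0 (by simp)]
        exact min_le_left _ _
      · rw [min_eq_right h]
        exact (min_le_right _ _).trans (le_mul_of_one_le_left (by simp) hβ1)
    have h3 : X ≤ Y + X / 2 := by
      calc X ≤ (β : ℝ≥0∞) ^ q * (a ^ q * μ univ + δ * X +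
            (γ : ℝ≥0∞)⁻¹ ^ q * ∫⁻ x, G x ^ q ∂μ) := h2.trans (by gcongr)
        _ = Y + ((β : ℝ≥0∞) ^ q * δ) * X := by simp only [Y]; ring
        _ ≤ Y + 1 / 2 * X := by gcongr
        _ = Y + X / 2 := by rw [one_div, ENNReal.div_eq_inv_mul]
    have h4 : X / 2 ≤ Y := by
      have hX2 : X / 2 ≠ ∞ := ENNReal.div_ne_top hXt (by simp)
      refine (ENNReal.add_le_add_iff_right hX2).mp ?_
      rwa [ENNReal.add_halves]
    calc X = 2 * (X / 2) := (ENNReal.mul_div_cancel (by simp) (by simp)).symm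
      _ ≤ _ := by gcongr
  have hlim : Tendsto (fun n : ℕ => ∫⁻ x, (min (H x) n) ^ q ∂μ) atTop (𝓝 (∫⁻ x, H x ^ q ∂μ)) := by
    refine lintegral_tendsto_of_tendsto_of_monotone (fun n => by fun_prop)
      (Eventually.of_forall fun x m n hmn => ?_) (Eventually.of_forall fun x => ?_)
    · refine ENNReal.rpow_le_rpow (min_le_min_left _ ?_) hq.le
      exact_mod_cast hmn
    · have h := (tendsto_const_nhds (x := H x)).min ENNReal.tendsto_nat_nhds_top
      rw [min_eq_left le_top] at h
      exact (ENNReal.continuous_rpow_const.tendsto (H x)).comp h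
  exact le_of_tendsto' hlim trunc

/-- On every ball `B`, `h` is controlled by a part `h₁` with small integral when `g` is small near
`B`, and by a part `h₂` which satisfies a weighted reverse Hölder inequality on `B`. -/
def HasReverseHolderDecomposition {d : ℕ} (s : ℝ) (K C₀ N : ℝ≥0)
    (w h g : EuclideanSpace ℝ (Fin d) → ℝ≥0∞) : Prop :=
  ∀ (c : EuclideanSpace ℝ (Fin d)) (r : ℝ), 0 < r →
    ∃ h₁ h₂ : EuclideanSpace ℝ (Fin d) → ℝ≥0∞, Measurable h₁ ∧ Measurable h₂ ∧
      (∀ᵐ x, h x ≤ K * (h₁ x + h₂ x)) ∧ (∀ᵐ x, h₂ x ≤ K * (h x + h₁ x)) ∧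
      ∫⁻ x, h₁ x ≤ C₀ * ∫⁻ x in ball c (4 * r), g x ∧
      ∀ t : ℝ≥0∞, ∫⁻ x in ball c (3 * r), h₂ x ≤ t * volume (ball c (3 * r)) →
        (∀ (c' : EuclideanSpace ℝ (Fin d)) (r' : ℝ), ball c r ⊆ ball c' r' →
          ∫⁻ x in ball c' r', g x ≤ t * volume (ball c' r')) →
        ∫⁻ x in ball c r, h₂ x ^ s ∂(volume.withDensity w) ≤
          N * t ^ s * volume.withDensity w (ball c r)

section GoodLambda

variable {d : ℕ}

theorem setLIntegral_ball_le_of_maximalFunction_le {g : EuclideanSpace ℝ (Fin d) → ℝ≥0∞}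
    {x c : EuclideanSpace ℝ (Fin d)} {r : ℝ} {a : ℝ≥0∞} (hx : x ∈ ball c r)
    (hg : maximalFunction volume g x ≤ a) : ∫⁻ y in ball c r, g y ≤ a * volume (ball c r) := by
  have hr := pos_of_mem_ball hx
  rw [← ENNReal.div_le_iff (volume_ball_ne_zero c hr) (volume_ball_ne_top c r)]
  exact (le_maximalFunction volume g hx).trans hg

/-- A ball through `y` with average above `αa` has radius below `r`: otherwise it sits in a
concentric dilate of the stopping ball where the average is at most `a`, at a cost `8^d ≤ α`. Hence
it lies in `B(x, 8r)`, and only `h₂` on that ball matters. -/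
theorem lt_maximalFunction_or_lt_maximalFunction {h h₁ h₂ : EuclideanSpace ℝ (Fin d) → ℝ≥0∞}
    (hm₁ : Measurable h₁) {K α β : ℝ≥0} (hβ : K * (2 * β) = α) (hα : 8 ^ d ≤ α)
    (hK : ∀ᵐ x, h x ≤ K * (h₁ x + h₂ x)) {x : EuclideanSpace ℝ (Fin d)} {r : ℝ}
    {a : ℝ≥0∞} (hrad : ∀ ρ, 2 * r ≤ ρ → ∫⁻ y in ball x ρ, h y ≤ a * volume (ball x ρ))
    {y : EuclideanSpace ℝ (Fin d)} (hy : y ∈ ball x (6 * r))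
    (hlt : α * a < maximalFunction volume h y) :
    β * a < maximalFunction volume h₁ y ∨
      β * a < maximalFunction volume ((ball x (8 * r)).indicator h₂) y := by
  obtain ⟨c, ρ, hyc, hav⟩ := lt_maximalFunction_iff.mp hlt
  have hρ : 0 < ρ := pos_of_mem_ball hyc
  have hv0 := volume_ball_ne_zero c hρ
  have hvt := volume_ball_ne_top c ρ
  have hdy : dist y x < 6 * r := hy
  have hdc : dist y c < ρ := hyc
  have hr : ρ < r := by
    by_contra! hcon
    have hsub : ball c ρ ⊆ ball x (8 * ρ) := by
      intro z hz
      have hz' : dist z c < ρ := hz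
      have := dist_triangle4 z c y x
      rw [dist_comm c y] at this
      exact mem_ball.mpr (by linarith)
    refine absurd hav (not_lt.mpr ?_)
    rw [ENNReal.div_le_iff hv0 hvt]
    calc ∫⁻ y in ball c ρ, h y ≤ ∫⁻ y in ball x (8 * ρ), h y := lintegral_mono_set hsub
      _ ≤ a * volume (ball x (8 * ρ)) := hrad _ (by linarith)
      _ = 8 ^ d * a * volume (ball c ρ) := by
        rw [volume_ball_mul x c (by norm_num), ENNReal.ofReal_pow (by norm_num)]
        simp only [ENNReal.ofReal_ofNat]
        ring
      _ ≤ _ := by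
        gcongr
        exact_mod_cast hα
  have hsub : ball c ρ ⊆ ball x (8 * r) := by
    intro z hz
    have hz' : dist z c < ρ := hz
    have := dist_triangle4 z c y x
    rw [dist_comm c y] at this
    exact mem_ball.mpr (by linarith)
  by_contra! hcon
  refine absurd hav (not_lt.mpr ?_)
  have h2 : ∫⁻ z in ball c ρ, h₂ z = ∫⁻ z in ball c ρ, (ball x (8 * r)).indicator h₂ z :=
    setLIntegral_congr_fun measurableSet_ball fun z hz => (indicator_of_mem (hsub hz) _).symm
  calc (∫⁻ z in ball c ρ, h z) / volume (ball c ρ) ≤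
        (∫⁻ z in ball c ρ, K * (h₁ z + h₂ z)) / volume (ball c ρ) := by
        gcongr 1
        exact lintegral_mono_ae (ae_restrict_of_ae hK)
    _ = K * ((∫⁻ z in ball c ρ, h₁ z) / volume (ball c ρ) +
        (∫⁻ z in ball c ρ, (ball x (8 * r)).indicator h₂ z) / volume (ball c ρ)) := by
        rw [lintegral_const_mul' _ _ (by simp), lintegral_add_left hm₁, mul_div_assoc,
          ENNReal.add_div, h2]
    _ ≤ K * (β * a + β * a) := by
        gcongr
        · exact (le_maximalFunction _ _ hyc).trans hcon.1
        · exact (le_maximalFunction _ _ hyc).trans hcon.2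
    _ = α * a := by
        rw [← hβ]
        push_cast
        ring

end GoodLambda

/-- The decomposition is taken on `B = B(x, 8r)`. The level set of `M h₁` has small volume by the
weak (1,1) bound, hence small weight by `A_∞`; that of `M(1_B h₂)` is bounded by Chebyshev in
`L^s(w)`. The constant precedes `α` because `α` is chosen from it later, and `γ` may depend on `α`.
-/
theorem exists_local_good_lambda (d : ℕ) {q q' s : ℝ} (A : ℝ≥0) {K : ℝ≥0} (C₀ N : ℝ≥0)
    (hqs : q < s) (hK : 1 ≤ K) : ∃ C : ℝ≥0, ∀ α : ℝ≥0, 8 ^ d ≤ α → ∃ γ : ℝ≥0, 0 < γ ∧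
      ∀ w σ : EuclideanSpace ℝ (Fin d) → ℝ≥0∞, IsMuckenhouptPair q q' A w σ →
      ∀ h g : EuclideanSpace ℝ (Fin d) → ℝ≥0∞, HasReverseHolderDecomposition s K C₀ N w h g →
      ∀ (x : EuclideanSpace ℝ (Fin d)) (r : ℝ), 0 < r → ∀ a : ℝ≥0∞, a ≠ 0 → a ≠ ∞ →
        (∀ ρ, 2 * r ≤ ρ → ∫⁻ y in ball x ρ, h y ≤ a * volume (ball x ρ)) →
        maximalFunction volume g x ≤ γ * a →
          volume.withDensity w ({y | α * a < maximalFunction volume h y} ∩ ball x (6 * r)) ≤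
            C * (α ^ s)⁻¹ * volume.withDensity w (ball x (8 * r)) := by
  by_cases hc : q.HolderConjugate q'
  swap
  · exact ⟨0, fun α _ => ⟨1, one_pos, fun w σ P => absurd P.conj hc⟩⟩
  have hs : 0 < s := hc.pos.trans hqs
  obtain ⟨C₁, hC₁⟩ := exists_lintegral_maximalFunction_rpow_le_of_lt d (q' := q') A hqs
  -- `κa` bounds both the average of `h₂` over `3B` (first summand) and the averages of `g`, which
  -- are at most `γa ≤ a` (the final `1`).
  set κ : ℝ≥0 := K * (1 + C₀ * 4 ^ d) + 1
  refine ⟨C₁ * N * (2 * K * κ) ^ s + 1, fun α hα => ?_⟩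
  have hα0 : 0 < α := lt_of_lt_of_le (by positivity) hα
  have hK0 : 0 < K := one_pos.trans_le hK
  obtain ⟨ε, hε, hAinf⟩ := exists_withDensity_le_of_volume_le d q q' A
    (η := (α ^ s)⁻¹) (by positivity)
  set β : ℝ≥0 := α / (2 * K)
  have hβ0 : 0 < β := by positivity
  have hβ : K * (2 * β) = α := by simp only [β]; field_simp
  -- Here `24 = 6 · 4`, from the weak-type constant and the passage from `B` to `4B`; `C₀ + 1` keeps
  -- `γ` positive when `C₀ = 0`.
  set γ : ℝ≥0 := min 1 (ε * β / (24 ^ d * (C₀ + 1)))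
  have hγ0 : 0 < γ := by positivity
  have hγ1 : (γ : ℝ≥0∞) ≤ 1 := by exact_mod_cast min_le_left _ _
  have hγε : (24 : ℝ≥0∞) ^ d * C₀ * γ ≤ ε * β := by
    have h1 : 24 ^ d * (C₀ + 1) * γ ≤ ε * β := by
      calc 24 ^ d * (C₀ + 1) * γ ≤ 24 ^ d * (C₀ + 1) * (ε * β / (24 ^ d * (C₀ + 1))) := by
            gcongr; exact min_le_right _ _
        _ = ε * β := by field_simp
    have h2 : 24 ^ d * C₀ * γ ≤ ε * β := le_trans (by gcongr; simp) h1
    exact_mod_cast h2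
  refine ⟨γ, hγ0, fun w σ P h g hdec x r hr a ha0 hat hrad hg => ?_⟩
  obtain ⟨h₁, h₂, hm₁, hm₂, hle, hle₂, hint₁, hRH⟩ := hdec x (8 * r) (by linarith)
  set W := volume.withDensity w
  set B := ball x (8 * r)
  have hv0 : volume B ≠ 0 := volume_ball_ne_zero x (by linarith)
  have hvt : volume B ≠ ∞ := volume_ball_ne_top x _
  have hβ0' : (β : ℝ≥0∞) ≠ 0 := by exact_mod_cast hβ0.ne'
  have hβa0 : β * a ≠ 0 := mul_ne_zero hβ0' ha0
  have hβat : β * a ≠ ∞ := ENNReal.mul_ne_top (by simp) hat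
  have hint : ∫⁻ z, h₁ z ≤ C₀ * 4 ^ d * (γ * a) * volume B := by
    refine hint₁.trans ?_
    calc C₀ * ∫⁻ z in ball x (4 * (8 * r)), g z ≤
          C₀ * (γ * a * volume (ball x (4 * (8 * r)))) := by
          gcongr
          exact setLIntegral_ball_le_of_maximalFunction_le (mem_ball_self (by linarith)) hg
      _ = _ := by
          rw [volume_ball_mul x x (by norm_num), ENNReal.ofReal_pow (by norm_num)]
          simp only [ENNReal.ofReal_ofNat]
          ring
  have hsub : {y | α * a < maximalFunction volume h y} ∩ ball x (6 * r) ⊆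
      {y | β * a < maximalFunction volume (B.indicator h₂) y} ∪
        ({y | β * a < maximalFunction volume h₁ y} ∩ B) := by
    rintro y ⟨hy1, hy2⟩
    rcases lt_maximalFunction_or_lt_maximalFunction hm₁ hβ hα hle hrad hy2 hy1 with h | h
    · exact .inr ⟨h, ball_subset_ball (by linarith) hy2⟩
    · exact .inl h
  have hpart₁ : W ({y | β * a < maximalFunction volume h₁ y} ∩ B) ≤ ((α ^ s)⁻¹ : ℝ≥0) * W B := by
    refine hAinf w σ P x (8 * r) (by linarith) _ inter_subset_right
      ((isOpen_lt_maximalFunction _ _ _).measurableSet.inter measurableSet_ball) ?_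
    have hwk := (isDoublingWith_volume d).mul_measure_lt_maximalFunction_le h₁ (β * a)
    rw [← ENNReal.mul_le_mul_iff_right hβa0 hβat]
    calc β * a * volume ({y | β * a < maximalFunction volume h₁ y} ∩ B) ≤
          β * a * volume {y | β * a < maximalFunction volume h₁ y} := by
          gcongr; exact inter_subset_left
      _ ≤ 6 ^ d * (C₀ * 4 ^ d * (γ * a) * volume B) := by
          refine hwk.trans ?_
          push_cast
          gcongr
      _ = (24 ^ d * C₀ * γ) * a * volume B := by
          rw [show (24 : ℝ≥0∞) = 6 * 4 by norm_num, mul_pow]; ring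
      _ ≤ (ε * β) * a * volume B := by gcongr
      _ = _ := by ring
  have hRH' : ∫⁻ z in B, h₂ z ^ s ∂W ≤ N * (κ * a) ^ s * W B := by
    refine hRH _ ?_ fun c' r' hB' => ?_
    · have hB3 : volume B ≤ volume (ball x (3 * (8 * r))) :=
        measure_mono (ball_subset_ball (by linarith))
      calc ∫⁻ z in ball x (3 * (8 * r)), h₂ z ≤ ∫⁻ z in ball x (3 * (8 * r)), K * (h z + h₁ z) :=
            lintegral_mono_ae (ae_restrict_of_ae hle₂)
        _ = K * ((∫⁻ z in ball x (3 * (8 * r)), h z) + ∫⁻ z in ball x (3 * (8 * r)), h₁ z) := by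
            rw [lintegral_const_mul' _ _ (by simp), lintegral_add_right _ hm₁]
        _ ≤ K * (a * volume (ball x (3 * (8 * r))) +
            C₀ * 4 ^ d * (1 * a) * volume (ball x (3 * (8 * r)))) := by
            gcongr
            · exact hrad _ (by linarith)
            · refine (setLIntegral_le_lintegral _ _).trans (hint.trans ?_)
              gcongr
        _ = (K * (1 + C₀ * 4 ^ d) : ℝ≥0) * a * volume (ball x (3 * (8 * r))) := by
            push_cast; ring
        _ ≤ _ := by
            gcongr
            simp [κ]
    · refine (setLIntegral_ball_le_of_maximalFunction_le
        (hB' (mem_ball_self (by linarith))) hg).trans ?_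
      gcongr
      have : (1 : ℝ≥0∞) ≤ κ := by
        have : 1 ≤ κ := le_add_of_nonneg_left zero_le
        exact_mod_cast this
      exact_mod_cast hγ1.trans this
  have hpart₂ : W {y | β * a < maximalFunction volume (B.indicator h₂) y} ≤
      (C₁ * N * (2 * K * κ) ^ s * (α ^ s)⁻¹ : ℝ≥0) * W B := by
    have hmark := mul_meas_ge_le_lintegral (μ := W)
      ((measurable_maximalFunction volume (B.indicator h₂)).pow_const s) ((β * a) ^ s)
    have hind : ∫⁻ z, B.indicator h₂ z ^ s ∂W = ∫⁻ z in B, h₂ z ^ s ∂W := by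
      rw [← lintegral_indicator measurableSet_ball]
      refine lintegral_congr fun z => ?_
      by_cases hz : z ∈ B
      · rw [indicator_of_mem hz, indicator_of_mem (show z ∈ ball x (8 * r) from hz)]
      · rw [indicator_of_notMem hz, indicator_of_notMem (show z ∉ ball x (8 * r) from hz),
          ENNReal.zero_rpow_of_pos hs]
    have hpow0 : (β * a) ^ s ≠ 0 := by simp [hβa0, hβat]
    have hpowt : (β * a) ^ s ≠ ∞ := ENNReal.rpow_ne_top_of_nonneg hs.le hβat
    rw [← ENNReal.mul_le_mul_iff_right hpow0 hpowt]
    calc (β * a) ^ s * W {y | β * a < maximalFunction volume (B.indicator h₂) y} ≤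
          (β * a) ^ s * W {y | (β * a) ^ s ≤ maximalFunction volume (B.indicator h₂) y ^ s} := by
          refine mul_le_mul' le_rfl (measure_mono fun y hy => ?_)
          exact ENNReal.rpow_le_rpow (le_of_lt hy) hs.le
      _ ≤ C₁ * (N * (κ * a) ^ s * W B) := by
          refine hmark.trans ((hC₁ w σ P _ (hm₂.indicator measurableSet_ball)).trans ?_)
          rw [hind]
          gcongr
      _ = (C₁ * N * κ ^ s : ℝ≥0) * a ^ s * W B := by
          rw [ENNReal.mul_rpow_of_nonneg _ _ hs.le]
          push_cast
          rw [ENNReal.coe_rpow_of_nonneg _ hs.le]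
          ring
      _ = (β ^ s * (C₁ * N * (2 * K * κ) ^ s * (α ^ s)⁻¹) : ℝ≥0) * a ^ s * W B := by
          congr 3
          have : α ^ s = (2 * K) ^ s * β ^ s := by
            rw [← NNReal.mul_rpow, ← hβ]; ring_nf
          have h1 : (2 * K) ^ s ≠ 0 := by positivity
          have h2 : β ^ s ≠ 0 := by positivity
          rw [this, NNReal.mul_rpow (x := 2 * K) (y := κ)]
          field_simp
      _ = _ := by
          rw [ENNReal.mul_rpow_of_nonneg _ _ hs.le, ← ENNReal.coe_rpow_of_nonneg _ hs.le]
          push_cast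
          ring
  refine (measure_mono hsub).trans ((measure_union_le _ _).trans
    ((add_le_add hpart₂ hpart₁).trans ?_))
  rw [← add_mul, ← ENNReal.coe_add]
  refine mul_le_mul_left (le_of_eq ?_) _
  norm_cast
  ring

/-- The centre is `x` pulled towards the origin by at most `r / 2`. With doubling, this shows that
intersecting a stopping ball with `B(0, R)` loses only a constant factor of weight. -/
theorem exists_ball_subset_inter_ball_zero {V : Type*} [NormedAddCommGroup V] [NormedSpace ℝ V]
    {x : V} {r R : ℝ} (hr : 0 < r) (hrR : r < R) (hx : x ∈ ball (0 : V) R) :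
    ∃ c, ball c (r / 2) ⊆ ball x r ∩ ball 0 R := by
  have hR : 0 < R := hr.trans hrR
  have hx' : ‖x‖ < R := by simpa using hx
  have hk : 0 ≤ 1 - r / (2 * R) := by
    rw [sub_nonneg, div_le_one (by positivity)]; linarith
  have hkR : r / (2 * R) * R = r / 2 := by field_simp
  refine ⟨(1 - r / (2 * R)) • x, subset_inter (ball_subset_ball' ?_) (ball_subset_ball' ?_)⟩
  · have : (1 - r / (2 * R)) • x - x = -((r / (2 * R)) • x) := by module
    rw [dist_eq_norm, this, norm_neg, norm_smul, Real.norm_of_nonneg (by positivity)]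
    have : r / (2 * R) * ‖x‖ ≤ r / (2 * R) * R := by gcongr
    linarith
  · rw [dist_zero_right, norm_smul, Real.norm_of_nonneg hk]
    have : (1 - r / (2 * R)) * ‖x‖ ≤ (1 - r / (2 * R)) * R := by gcongr
    linarith

/-- The local estimate is summed over a Vitali family of stopping balls, whose disjoint traces on
`B(0, R)` lie in `{Mh > a}`. -/
theorem exists_good_lambda (d : ℕ) {q q' s : ℝ} (A : ℝ≥0) {K : ℝ≥0} (C₀ N : ℝ≥0)
    (hqs : q < s) (hK : 1 ≤ K) : ∃ C : ℝ≥0, ∀ α : ℝ≥0, 8 ^ d ≤ α → ∃ γ : ℝ≥0, 0 < γ ∧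
      ∀ w σ : EuclideanSpace ℝ (Fin d) → ℝ≥0∞, IsMuckenhouptPair q q' A w σ →
      ∀ h g : EuclideanSpace ℝ (Fin d) → ℝ≥0∞, HasReverseHolderDecomposition s K C₀ N w h g →
      ∀ (R : ℝ) (a : ℝ≥0∞), a ≠ 0 → a ≠ ∞ →
        ∫⁻ x, h x ≤ a * volume (ball (0 : EuclideanSpace ℝ (Fin d)) R) →
          volume.withDensity w ({x | α * a < maximalFunction volume h x ∧
              maximalFunction volume g x ≤ γ * a} ∩ ball 0 R) ≤
            C * (α ^ s)⁻¹ *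
              volume.withDensity w ({x | a < maximalFunction volume h x} ∩ ball 0 R) := by
  by_cases hc : q.HolderConjugate q'
  swap
  · exact ⟨0, fun α _ => ⟨1, one_pos, fun w σ P => absurd P.conj hc⟩⟩
  obtain ⟨C, hC⟩ := exists_local_good_lambda d (q := q) (q' := q') A C₀ N hqs hK
  refine ⟨C * (A * 16 ^ d) ^ q, fun α hα => ?_⟩
  obtain ⟨γ, hγ, hloc⟩ := hC α hα
  refine ⟨γ, hγ, fun w σ P h g hdec R a ha0 hat hR => ?_⟩
  set W := volume.withDensity w
  set t : Set (EuclideanSpace ℝ (Fin d)) := {x | α * a < maximalFunction volume h x ∧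
    maximalFunction volume g x ≤ γ * a} ∩ ball 0 R
  have hrad : ∀ x : EuclideanSpace ℝ (Fin d), ∃ r, x ∈ t → 0 < r ∧ r < R ∧
      a * volume (ball x r) < ∫⁻ y in ball x r, h y ∧
      ∀ ρ, 2 * r ≤ ρ → ∫⁻ y in ball x ρ, h y ≤ a * volume (ball x ρ) := by
    intro x
    by_cases hx : x ∈ t
    · obtain ⟨c, ρ, hxc, hav⟩ := lt_maximalFunction_iff.mp hx.1.1
      have hρ := pos_of_mem_ball hxc
      have hxc' : dist x c < ρ := hxc
      rw [ENNReal.lt_div_iff_mul_lt (.inl (volume_ball_ne_zero c hρ))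
        (.inl (volume_ball_ne_top c ρ))] at hav
      -- Passing to a ball centred at `x` doubles the radius and costs `2^d ≤ α`.
      obtain ⟨r, hr⟩ := exists_stopping_radius hR (x := x) ⟨2 * ρ, by linarith, by
        calc a * volume (ball x (2 * ρ)) = 2 ^ d * a * volume (ball c ρ) := by
              rw [volume_ball_mul x c (by norm_num), ENNReal.ofReal_pow (by norm_num)]
              simp only [ENNReal.ofReal_ofNat]
              ring
          _ ≤ α * a * volume (ball c ρ) := by
              gcongr
              have : (2 : ℝ≥0) ^ d ≤ α := le_trans (by gcongr; norm_num) hα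
              exact_mod_cast this
          _ < ∫⁻ y in ball c ρ, h y := hav
          _ ≤ ∫⁻ y in ball x (2 * ρ), h y := by
              refine lintegral_mono_set (ball_subset_ball' ?_)
              rw [dist_comm]; linarith⟩
      exact ⟨r, fun _ => hr⟩
    · exact ⟨0, fun h => absurd h hx⟩
  choose r hr using hrad
  obtain ⟨u, hut, hu, hd, hcov⟩ := exists_countable_disjoint_balls_covering t id r R
    (fun x hx => (hr x hx).1) (fun x hx => (hr x hx).2.1.le)
  simp only [id_eq] at hd hcov
  have hsub : t ⊆ ⋃ b ∈ u, {y | α * a < maximalFunction volume h y} ∩ ball b (6 * r b) := by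
    intro x hx
    obtain ⟨b, hb, hb'⟩ := hcov x hx
    exact mem_biUnion hb ⟨hx.1.1, hb' (mem_ball_self (hr x hx).1)⟩
  have hsub2 : (⋃ b ∈ u, ball b (r b) ∩ ball 0 R) ⊆
      {x | a < maximalFunction volume h x} ∩ ball 0 R := by
    refine iUnion₂_subset fun b hb y hy => ⟨?_, hy.2⟩
    obtain ⟨h1, -, h2, -⟩ := hr b (hut hb)
    refine lt_maximalFunction_iff.mpr ⟨b, r b, hy.1, ?_⟩
    rwa [ENNReal.lt_div_iff_mul_lt (.inl (volume_ball_ne_zero b h1))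
      (.inl (volume_ball_ne_top b _))]
  calc W t ≤ ∑' b : u, W ({y | α * a < maximalFunction volume h y} ∩ ball b.1 (6 * r b)) :=
        (measure_mono hsub).trans (measure_biUnion_le _ hu _)
    _ ≤ ∑' b : u, C * (α ^ s)⁻¹ * (((A * 16 ^ d) ^ q : ℝ≥0) * W (ball b.1 (r b) ∩ ball 0 R)) := by
        refine ENNReal.tsum_le_tsum fun b => ?_
        obtain ⟨h1, h2, -, h3⟩ := hr b.1 (hut b.2)
        refine (hloc w σ P h g hdec b.1 (r b) h1 a ha0 hat h3 (hut b.2).1.2).trans ?_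
        gcongr
        obtain ⟨c, hcb⟩ := exists_ball_subset_inter_ball_zero h1 h2 (hut b.2).2
        have h4 : ball c (r b / 2) ⊆ ball b.1 (16 * (r b / 2)) :=
          (hcb.trans inter_subset_left).trans (ball_subset_ball (by linarith))
        have h5 := P.withDensity_ball_mul_le (by norm_num) (half_pos h1) h4
        rw [show 16 * (r b / 2) = 8 * r b by ring, ENNReal.ofReal_pow (by norm_num)] at h5
        rw [ENNReal.coe_rpow_of_nonneg _ hc.nonneg]
        push_cast
        simp only [ENNReal.ofReal_ofNat] at h5
        exact h5.trans (by gcongr)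
    _ = C * (α ^ s)⁻¹ * (((A * 16 ^ d) ^ q : ℝ≥0) * W (⋃ b ∈ u, ball b (r b) ∩ ball 0 R)) := by
        rw [ENNReal.tsum_mul_left, ENNReal.tsum_mul_left, measure_biUnion hu
          (fun a ha b hb hab => (hd ha hb hab).mono inter_subset_left inter_subset_left)
          fun _ _ => measurableSet_ball.inter measurableSet_ball]
    _ ≤ C * (α ^ s)⁻¹ * (((A * 16 ^ d) ^ q : ℝ≥0) *
        W ({x | a < maximalFunction volume h x} ∩ ball 0 R)) := by gcongr
    _ = _ := by push_cast; ring

/-- Shen's real-variable argument with an `A_q` weight. -/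
theorem exists_lintegral_rpow_withDensity_le (d : ℕ) (hd : 1 ≤ d) {q q' s : ℝ} (A : ℝ≥0) {K : ℝ≥0}
    (C₀ N : ℝ≥0) (hqs : q < s) (hK : 1 ≤ K) : ∃ C : ℝ≥0,
      ∀ w σ : EuclideanSpace ℝ (Fin d) → ℝ≥0∞, IsMuckenhouptPair q q' A w σ →
      ∀ h g : EuclideanSpace ℝ (Fin d) → ℝ≥0∞, Measurable h → Measurable g → ∫⁻ x, h x ≠ ∞ →
        HasReverseHolderDecomposition s K C₀ N w h g →
          ∫⁻ x, h x ^ q ∂(volume.withDensity w) ≤ C * ∫⁻ x, g x ^ q ∂(volume.withDensity w) := by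
  by_cases hc : q.HolderConjugate q'
  swap
  · exact ⟨0, fun w σ P => absurd P.conj hc⟩
  have hq : 0 < q := hc.pos
  obtain ⟨C₁, hC₁⟩ := exists_good_lambda d (q := q) (q' := q') A C₀ N hqs hK
  obtain ⟨C₂, hC₂⟩ := exists_lintegral_maximalFunction_rpow_le d q q' A
  -- The second entry gives `α^{s-q} ≥ 2 C₁`, which is the absorption condition; this is where `q <
  -- s` is essential.
  set α : ℝ≥0 := max (8 ^ d) ((2 * C₁) ^ (1 / (s - q)))
  have hα1 : 1 ≤ α := (one_le_pow₀ (by norm_num)).trans (le_max_left _ _)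
  have hα0 : 0 < α := one_pos.trans_le hα1
  obtain ⟨γ, hγ, hgood⟩ := hC₁ α (le_max_left _ _)
  have hδ : α ^ q * (C₁ * (α ^ s)⁻¹) ≤ 1 / 2 := by
    have h1 : 2 * C₁ ≤ α ^ (s - q) := by
      calc 2 * C₁ = ((2 * C₁) ^ (1 / (s - q))) ^ (s - q) := by
            rw [← NNReal.rpow_mul, one_div_mul_cancel (by linarith), NNReal.rpow_one]
        _ ≤ _ := NNReal.rpow_le_rpow (le_max_right _ _) (by linarith)
    have h2 : α ^ s = α ^ q * α ^ (s - q) := by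
      rw [← NNReal.rpow_add hα0.ne']; ring_nf
    have h3 : 0 < α ^ q := by positivity
    have h4 : 0 < α ^ (s - q) := by positivity
    rw [h2, show α ^ q * (C₁ * (α ^ q * α ^ (s - q))⁻¹) = C₁ / α ^ (s - q) by field_simp,
      div_le_iff₀ h4, one_div, ← div_eq_inv_mul, le_div_iff₀ (by norm_num), mul_comm]
    exact h1
  refine ⟨2 * (α ^ q * (γ⁻¹ ^ q * C₂)), fun w σ P h g hh hg hfin hdec => ?_⟩
  set W := volume.withDensity w
  set I := ∫⁻ x, h x
  have hball : ∀ n : ℕ, 1 ≤ n → ∫⁻ x in ball 0 (n : ℝ), h x ^ q ∂W ≤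
      2 * ((α : ℝ≥0∞) ^ q * (I ^ q * (W (ball 0 n) /
        volume (ball (0 : EuclideanSpace ℝ (Fin d)) n) ^ q))) +
        (2 * (α ^ q * (γ⁻¹ ^ q * C₂)) : ℝ≥0) * ∫⁻ x, g x ^ q ∂W := by
    intro n hn
    have hn0 : (0 : ℝ) < n := by exact_mod_cast hn
    set B := ball (0 : EuclideanSpace ℝ (Fin d)) n
    have hv0 : volume B ≠ 0 := volume_ball_ne_zero _ hn0
    have hvt : volume B ≠ ∞ := volume_ball_ne_top _ _
    have : IsFiniteMeasure (W.restrict B) :=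
      ⟨by simpa using (P.withDensity_ball_ne_top 0 n).lt_top⟩
    have habs := lintegral_rpow_le_of_good_lambda (μ := W.restrict B)
      (measurable_maximalFunction volume h) (measurable_maximalFunction volume g) hq hα1 hγ hδ
      -- The least level at which the good-`λ` inequality is available on `B`.
      (a := I / volume B) (by
        intro t ht0 htt hta
        have hI : I ≤ t * volume B := by rwa [ENNReal.div_le_iff hv0 hvt] at hta
        have h1 := hgood w σ P h g hdec n t ht0 htt hI
        have hm : ∀ (k : EuclideanSpace ℝ (Fin d) → ℝ≥0∞) (b : ℝ≥0∞),
            W.restrict B {x | b < maximalFunction volume k x} =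
              W ({x | b < maximalFunction volume k x} ∩ B) := fun k b =>
          Measure.restrict_apply (isOpen_lt_maximalFunction _ _ _).measurableSet
        rw [hm, hm, hm]
        calc W ({x | α * t < maximalFunction volume h x} ∩ B) ≤
              W (({x | α * t < maximalFunction volume h x ∧
                maximalFunction volume g x ≤ γ * t} ∩ B) ∪
                ({x | γ * t < maximalFunction volume g x} ∩ B)) := by
              refine measure_mono fun x hx => ?_
              rcases le_or_gt (maximalFunction volume g x) (γ * t) with h | h
              · exact .inl ⟨⟨hx.1, h⟩, hx.2⟩
              · exact .inr ⟨h, hx.2⟩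
          _ ≤ _ := by
              refine (measure_union_le _ _).trans (add_le_add (h1.trans_eq ?_) le_rfl)
              push_cast
              rfl)
    calc ∫⁻ x in B, h x ^ q ∂W ≤ ∫⁻ x in B, maximalFunction volume h x ^ q ∂W := by
          refine lintegral_mono_ae (ae_restrict_of_ae ?_)
          filter_upwards [(withDensity_absolutelyContinuous volume w).ae_le
            (ae_le_maximalFunction hh hfin)] with x hx
          exact ENNReal.rpow_le_rpow hx hq.le
      _ ≤ _ := habs
      _ ≤ 2 * ((α : ℝ≥0∞) ^ q * ((I / volume B) ^ q * W B +
          (γ : ℝ≥0∞)⁻¹ ^ q * (C₂ * ∫⁻ x, g x ^ q ∂W))) := by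
          rw [Measure.restrict_apply_univ]
          gcongr
          exact (setLIntegral_le_lintegral _ _).trans (hC₂ w σ P g hg)
      _ = _ := by
          rw [ENNReal.div_rpow_of_nonneg _ _ hq.le, ← ENNReal.coe_inv hγ.ne',
            ← ENNReal.coe_rpow_of_nonneg _ hq.le, ← ENNReal.coe_rpow_of_nonneg _ hq.le]
          push_cast
          rw [div_eq_mul_inv, div_eq_mul_inv]
          ring
  have hL : Tendsto (fun n : ℕ => ∫⁻ x in ball 0 (n : ℝ), h x ^ q ∂W) atTop
      (𝓝 (∫⁻ x, h x ^ q ∂W)) := by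
    have hmono : Monotone fun n : ℕ => ball (0 : EuclideanSpace ℝ (Fin d)) n :=
      fun m n hmn => ball_subset_ball (by exact_mod_cast hmn)
    have h1 := tendsto_measure_iUnion_atTop (μ := W.withDensity fun x => h x ^ q) hmono
    rw [iUnion_ball_nat, withDensity_apply _ MeasurableSet.univ, Measure.restrict_univ] at h1
    refine h1.congr fun n => ?_
    simp only [Function.comp_apply]
    exact withDensity_apply _ measurableSet_ball
  have hRlim : Tendsto (fun n : ℕ => 2 * ((α : ℝ≥0∞) ^ q * (I ^ q * (W (ball 0 n) /
        volume (ball (0 : EuclideanSpace ℝ (Fin d)) n) ^ q))) +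
        (2 * (α ^ q * (γ⁻¹ ^ q * C₂)) : ℝ≥0) * ∫⁻ x, g x ^ q ∂W) atTop
      (𝓝 (0 + (2 * (α ^ q * (γ⁻¹ ^ q * C₂)) : ℝ≥0) * ∫⁻ x, g x ^ q ∂W)) := by
    refine Tendsto.add ?_ tendsto_const_nhds
    have h1 := P.tendsto_withDensity_ball_div hd
    have h2 := ENNReal.Tendsto.const_mul h1 (a := I ^ q)
      (.inr (ENNReal.rpow_ne_top_of_nonneg hq.le hfin))
    have h3 := ENNReal.Tendsto.const_mul h2 (a := (α : ℝ≥0∞) ^ q)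
      (.inr (ENNReal.rpow_ne_top_of_nonneg hq.le (by simp)))
    have h4 := ENNReal.Tendsto.const_mul h3 (a := 2) (.inr (by simp))
    simpa only [mul_zero] using h4
  rw [zero_add] at hRlim
  exact le_of_tendsto_of_tendsto hL hRlim (eventually_atTop.mpr ⟨1, hball⟩)

/-! ### From the `A_q` condition to a pair of weights -/

namespace IsApWeight

variable {d : ℕ} {q : ℝ} {A : ℝ≥0} {ω : EuclideanSpace ℝ (Fin d) → ℝ}

theorem aemeasurable (hω : IsApWeight d q A ω) :
    AEMeasurable (fun x => ENNReal.ofReal (ω x)) volume :=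
  hω.locallyIntegrable.aestronglyMeasurable.aemeasurable.ennreal_ofReal

theorem setLIntegral_ne_top (hω : IsApWeight d q A ω) (c : EuclideanSpace ℝ (Fin d)) (r : ℝ) :
    ∫⁻ x in ball c r, ENNReal.ofReal (ω x) ≠ ∞ := by
  have h := hω.locallyIntegrable.integrableOn_isCompact (isCompact_closedBall c r)
  have h' := (h.mono_set ball_subset_closedBall).lintegral_lt_top
  exact h'.ne

theorem setLIntegral_rpow_ne_top (hω : IsApWeight d q A ω) (hq : 1 < q)
    {c : EuclideanSpace ℝ (Fin d)} {r : ℝ} (hr : 0 < r)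
    (h0 : ∫⁻ x in ball c r, ENNReal.ofReal (ω x) ≠ 0) :
    ∫⁻ x in ball c r, ENNReal.ofReal (ω x) ^ (-1 / (q - 1)) ≠ ∞ := by
  intro htop
  have h := hω.average_mul_average_le c r hr
  rw [setLAverage_eq, setLAverage_eq, htop, ENNReal.top_div_of_ne_top (volume_ball_ne_top c r),
    ENNReal.top_rpow_of_pos (by linarith), ENNReal.mul_top, top_le_iff] at h
  · exact ENNReal.coe_ne_top h
  · exact ENNReal.div_ne_zero.mpr ⟨h0, volume_ball_ne_top c r⟩

/-- If `ω` vanished on a non-null part of a ball where it is not almost everywhere zero, the dual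
average would be infinite against a positive average of `ω`. Any two balls about the origin lie in a
common larger one, so the alternative is global. -/
theorem ae_eq_zero_or_ae_ne_zero (hω : IsApWeight d q A ω) (hq : 1 < q) :
    (∀ᵐ x, ENNReal.ofReal (ω x) = 0) ∨ ∀ᵐ x, ENNReal.ofReal (ω x) ≠ 0 := by
  rw [or_iff_not_imp_left]
  intro hne
  have hint : ∫⁻ x, ENNReal.ofReal (ω x) ≠ 0 := by
    rwa [Ne, lintegral_eq_zero_iff' hω.aemeasurable]
  have hcov : ⋃ n : ℕ, ball (0 : EuclideanSpace ℝ (Fin d)) n = univ := iUnion_ball_nat 0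
  obtain ⟨m, hm⟩ : ∃ m : ℕ, ∫⁻ x in ball 0 (m : ℝ), ENNReal.ofReal (ω x) ≠ 0 := by
    by_contra! hcon
    refine hint (le_zero_iff.mp ?_)
    calc ∫⁻ x, ENNReal.ofReal (ω x) = ∫⁻ x in ⋃ n : ℕ, ball 0 (n : ℝ), ENNReal.ofReal (ω x) := by
          rw [hcov, Measure.restrict_univ]
      _ ≤ ∑' n : ℕ, ∫⁻ x in ball 0 (n : ℝ), ENNReal.ofReal (ω x) := lintegral_iUnion_le _ _
      _ = 0 := by simp [hcon]
  have hball : ∀ n : ℕ, ∀ᵐ x ∂(volume.restrict (ball 0 (n : ℝ))), ENNReal.ofReal (ω x) ≠ 0 := by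
    intro n
    have hsub : ball (0 : EuclideanSpace ℝ (Fin d)) n ⊆ ball 0 (n + m + 1) :=
      ball_subset_ball (by linarith [m.cast_nonneg (α := ℝ)])
    refine ae_restrict_of_ae_restrict_of_subset hsub ?_
    have h0 : ∫⁻ x in ball 0 ((n : ℝ) + m + 1), ENNReal.ofReal (ω x) ≠ 0 := by
      refine (lt_of_lt_of_le (pos_iff_ne_zero.mpr hm) (lintegral_mono_set ?_)).ne'
      exact ball_subset_ball (by linarith [n.cast_nonneg (α := ℝ)])
    filter_upwards [ae_lt_top' (hω.aemeasurable.restrict.pow_const _)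
      (hω.setLIntegral_rpow_ne_top hq (by positivity) h0)] with x hx hx0
    rw [hx0, ENNReal.zero_rpow_of_neg] at hx
    · exact lt_irrefl _ hx
    · exact div_neg_of_neg_of_pos (by norm_num) (by linarith)
  rw [← Measure.restrict_univ (μ := (volume : Measure (EuclideanSpace ℝ (Fin d)))), ← hcov,
    ae_restrict_iUnion_iff]
  exact hball

/-- `w` is a measurable representative of `ω` with the values `0` and `∞`, taken on a null set,
replaced by `1`. The constant becomes `A^{1/q}` because the pair condition is the `q`-th root of the
usual one. -/
theorem exists_isMuckenhouptPair (hω : IsApWeight d q A ω) {q' : ℝ} (hq : q.HolderConjugate q')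
    (h0 : ∀ᵐ x, ENNReal.ofReal (ω x) ≠ 0) : ∃ w σ : EuclideanSpace ℝ (Fin d) → ℝ≥0∞,
      IsMuckenhouptPair q q' (A ^ (1 / q)) w σ ∧ (fun x => ENNReal.ofReal (ω x)) =ᵐ[volume] w := by
  have hq1 := hq.sub_one_pos
  have hqp := hq.pos
  set u := hω.aemeasurable.mk
  have hu : Measurable u := hω.aemeasurable.measurable_mk
  set w : EuclideanSpace ℝ (Fin d) → ℝ≥0∞ := fun x => if u x = 0 ∨ u x = ∞ then 1 else u x
  have hw : Measurable w := Measurable.ite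
    ((measurableSet_eq_fun hu measurable_const).union (measurableSet_eq_fun hu measurable_const))
    measurable_const hu
  have hw0 : ∀ x, w x ≠ 0 := by
    intro x
    simp only [w]
    split_ifs with h
    · exact one_ne_zero
    · exact fun h' => h (.inl h')
  have hwt : ∀ x, w x ≠ ∞ := by
    intro x
    simp only [w]
    split_ifs with h
    · exact ENNReal.one_ne_top
    · exact fun h' => h (.inr h')
  have hae : (fun x => ENNReal.ofReal (ω x)) =ᵐ[volume] w := by
    filter_upwards [h0, hω.aemeasurable.ae_eq_mk] with x hx hxu
    have hxu' : ENNReal.ofReal (ω x) = u x := hxu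
    have : ¬ (u x = 0 ∨ u x = ∞) := by
      rw [← hxu']
      simp [hx]
    simp only [w, if_neg this, hxu']
  have hball : ∀ c r, ∫⁻ x in ball c r, ENNReal.ofReal (ω x) = ∫⁻ x in ball c r, w x :=
    fun c r => lintegral_congr_ae (ae_restrict_of_ae hae)
  have hball' : ∀ c r, ∫⁻ x in ball c r, ENNReal.ofReal (ω x) ^ (-1 / (q - 1)) =
      ∫⁻ x in ball c r, w x ^ (-1 / (q - 1)) := fun c r =>
    lintegral_congr_ae (ae_restrict_of_ae (hae.mono fun x hx => congrArg (· ^ (-1 / (q - 1))) hx))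
  refine ⟨w, fun x => w x ^ (-1 / (q - 1)), ⟨hq, hw, hw.pow_const _, fun x => ?_, fun c r => ?_,
    fun c r => ?_, fun c r hr => ?_⟩, hae⟩
  · rw [← ENNReal.rpow_mul, ← ENNReal.rpow_add _ _ (hw0 x) (hwt x)]
    have : 1 / q + -1 / (q - 1) * (1 / q') = 0 := by
      rw [div_mul_div_comm, hq.sub_one_mul_conj]
      ring
    rw [this, ENNReal.rpow_zero]
  · rw [← hball]
    exact hω.setLIntegral_ne_top c r
  · rcases le_or_gt r 0 with hr | hr
    · simp [ball_eq_empty.mpr hr]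
    · rw [← hball']
      refine hω.setLIntegral_rpow_ne_top hq.lt hr ?_
      rw [hball]
      refine ((setLIntegral_pos_iff hw).mpr ?_).ne'
      have : Function.support w = univ := by ext x; simp [hw0 x]
      rw [this, univ_inter]
      exact measure_ball_pos volume c hr
  · have h := ENNReal.rpow_le_rpow (hω.average_mul_average_le c r hr) hq.one_div_nonneg
    have hv0 := volume_ball_ne_zero c hr
    have hvt := volume_ball_ne_top c r
    rw [setLAverage_eq, setLAverage_eq, hball, hball',
      ENNReal.mul_rpow_of_nonneg _ _ hq.one_div_nonneg, ← ENNReal.rpow_mul,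
      show (q - 1) * (1 / q) = 1 / q' by
        rw [← hq.div_conj_eq_sub_one, div_mul_div_comm, mul_one, mul_comm q' q, ← div_div,
          div_self hq.ne_zero],
      ENNReal.div_rpow_of_nonneg _ _ hq.one_div_nonneg,
      ENNReal.div_rpow_of_nonneg _ _ hq.symm.one_div_nonneg] at h
    set V := volume (ball c r)
    set a := (∫⁻ x in ball c r, w x) ^ (1 / q)
    set b := (∫⁻ x in ball c r, w x ^ (-1 / (q - 1))) ^ (1 / q')
    have hV : V ^ (1 / q) * V ^ (1 / q') = V := by
      rw [← ENNReal.rpow_add _ _ hv0 hvt, one_div, one_div, hq.inv_add_inv_eq_one,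
        ENNReal.rpow_one]
    have hne : ∀ e : ℝ, V ^ e ≠ 0 ∧ V ^ e ≠ ∞ := fun e => by
      constructor <;> simp [hv0, hvt, ENNReal.rpow_eq_top_iff]
    calc a * b = (a / V ^ (1 / q) * V ^ (1 / q)) * (b / V ^ (1 / q') * V ^ (1 / q')) := by
          rw [ENNReal.div_mul_cancel (hne _).1 (hne _).2,
            ENNReal.div_mul_cancel (hne _).1 (hne _).2]
      _ = (a / V ^ (1 / q) * (b / V ^ (1 / q'))) * (V ^ (1 / q) * V ^ (1 / q')) := by ring
      _ ≤ _ := by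
          rw [hV, ENNReal.coe_rpow_of_nonneg _ hq.one_div_nonneg]
          gcongr

end IsApWeight

/-! ### Sublinear operators -/

namespace IsBoundedCompactlySupported

variable {d : ℕ} {E : Type*} [NormedAddCommGroup E] {f : EuclideanSpace ℝ (Fin d) → E}

theorem indicator (hf : IsBoundedCompactlySupported f) {s : Set (EuclideanSpace ℝ (Fin d))}
    (hs : MeasurableSet s) : IsBoundedCompactlySupported (s.indicator f) where
  aestronglyMeasurable := hf.aestronglyMeasurable.indicator hs
  bounded := by
    obtain ⟨M, hM⟩ := hf.bounded
    exact ⟨M, fun x => (norm_indicator_le_norm_self f x).trans (hM x)⟩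
  hasCompactSupport := hf.hasCompactSupport.mono (by
    rw [support_indicator]; exact inter_subset_right)

theorem neg (hf : IsBoundedCompactlySupported f) : IsBoundedCompactlySupported (-f) where
  aestronglyMeasurable := hf.aestronglyMeasurable.neg
  bounded := by
    obtain ⟨M, hM⟩ := hf.bounded
    exact ⟨M, fun x => by simpa using hM x⟩
  hasCompactSupport := hf.hasCompactSupport.mono (by rw [Function.support_neg])

end IsBoundedCompactlySupported

/-- Bounding the sum by twice the maximum works for all `p ≥ 0`, including exponents below one. -/
theorem enorm_rpow_le_of_norm_le {F : Type*} [NormedAddCommGroup F] {a b c : F} {K : ℝ≥0}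
    (h : ‖a‖ ≤ K * (‖b‖ + ‖c‖)) {p : ℝ} (hp : 0 ≤ p) :
    ‖a‖ₑ ^ p ≤ ((2 * K) ^ p : ℝ≥0) * (‖b‖ₑ ^ p + ‖c‖ₑ ^ p) := by
  have h1 : ‖a‖ₑ ≤ (2 * K : ℝ≥0) * max ‖b‖ₑ ‖c‖ₑ := by
    have h2 : ‖a‖ₑ ≤ K * (‖b‖ₑ + ‖c‖ₑ) := by
      have h3 : ‖a‖₊ ≤ K * (‖b‖₊ + ‖c‖₊) := by exact_mod_cast h
      simp only [enorm_eq_nnnorm]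
      exact_mod_cast h3
    calc ‖a‖ₑ ≤ K * (‖b‖ₑ + ‖c‖ₑ) := h2
      _ ≤ K * (max ‖b‖ₑ ‖c‖ₑ + max ‖b‖ₑ ‖c‖ₑ) := by
          gcongr
          · exact le_max_left _ _
          · exact le_max_right _ _
      _ = _ := by push_cast; ring
  calc ‖a‖ₑ ^ p ≤ ((2 * K : ℝ≥0) * max ‖b‖ₑ ‖c‖ₑ) ^ p := ENNReal.rpow_le_rpow h1 hp
    _ = ((2 * K) ^ p : ℝ≥0) * (max ‖b‖ₑ ‖c‖ₑ) ^ p := by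
        rw [ENNReal.mul_rpow_of_nonneg _ _ hp, ENNReal.coe_rpow_of_nonneg _ hp]
    _ ≤ _ := by
        refine mul_le_mul' le_rfl ?_
        rcases le_total ‖b‖ₑ ‖c‖ₑ with hbc | hbc
        · rw [max_eq_right hbc]; exact le_add_self
        · rw [max_eq_left hbc]; exact le_self_add

section Operator

variable {d : ℕ} {E F : Type*} [NormedAddCommGroup E] [NormedAddCommGroup F]
  {T : (EuclideanSpace ℝ (Fin d) → E) → (EuclideanSpace ℝ (Fin d) → F)}
  {f : EuclideanSpace ℝ (Fin d) → E} {p₀ p₁ : ℝ} {C₀ : ℝ≥0}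

theorem IsLpBoundedWith.lintegral_rpow_le (hT : IsLpBoundedWith p₀ C₀ T) (hp₀ : 0 < p₀)
    (hf : IsBoundedCompactlySupported f) :
    ∫⁻ x, ‖T f x‖ₑ ^ p₀ ≤ (C₀ ^ p₀ : ℝ≥0) * ∫⁻ x, ‖f x‖ₑ ^ p₀ := by
  have h := (hT f hf).2
  have hp0 : ENNReal.ofReal p₀ ≠ 0 := by simpa using hp₀
  rw [eLpNorm_eq_lintegral_rpow_enorm_toReal hp0 ENNReal.ofReal_ne_top,
    eLpNorm_eq_lintegral_rpow_enorm_toReal hp0 ENNReal.ofReal_ne_top,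
    ENNReal.toReal_ofReal hp₀.le] at h
  have h' := ENNReal.rpow_le_rpow h hp₀.le
  rwa [ENNReal.mul_rpow_of_nonneg _ _ hp₀.le, ← ENNReal.rpow_mul, ← ENNReal.rpow_mul,
    one_div_mul_cancel hp₀.ne', ENNReal.rpow_one, ENNReal.rpow_one,
    ← ENNReal.coe_rpow_of_nonneg _ hp₀.le] at h'

theorem IsLpBoundedWith.aemeasurable (hT : IsLpBoundedWith p₀ C₀ T)
    (hf : IsBoundedCompactlySupported f) : AEMeasurable (fun x => ‖T f x‖ₑ ^ p₀) volume :=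
  (hT f hf).1.aestronglyMeasurable.enorm.pow_const _

theorem IsLpBoundedWith.lintegral_ne_top (hT : IsLpBoundedWith p₀ C₀ T) (hp₀ : 0 < p₀)
    (hf : IsBoundedCompactlySupported f) : ∫⁻ x, ‖T f x‖ₑ ^ p₀ ≠ ∞ := by
  have hp0 : ENNReal.ofReal p₀ ≠ 0 := by simpa using hp₀
  have h := lintegral_rpow_enorm_lt_top_of_eLpNorm_lt_top hp0 ENNReal.ofReal_ne_top
    (hT f hf).1.eLpNorm_lt_top
  rw [ENNReal.toReal_ofReal hp₀.le] at h
  exact h.ne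

/-- The hypothesis without averages; `2N` comes from the two terms in braces, each at most
`t^{1/p₀}`. -/
theorem WeightedReverseHolder.setLIntegral_le {N : ℝ≥0} {ω : EuclideanSpace ℝ (Fin d) → ℝ}
    (hT : WeightedReverseHolder p₀ p₁ N ω T) (hp₀ : 0 < p₀) (hp₁ : 0 < p₁)
    {c : EuclideanSpace ℝ (Fin d)} {r : ℝ} (hr : 0 < r) (hf : IsBoundedCompactlySupported f)
    (hsupp : tsupport f ⊆ (ball c (4 * r))ᶜ) {t : ℝ≥0∞}
    (h₁ : ∫⁻ x in ball c (3 * r), ‖T f x‖ₑ ^ p₀ ≤ t * volume (ball c (3 * r)))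
    (h₂ : ∀ c' r', ball c r ⊆ ball c' r' →
      ∫⁻ x in ball c' r', ‖f x‖ₑ ^ p₀ ≤ t * volume (ball c' r')) :
    ∫⁻ x in ball c r, ‖T f x‖ₑ ^ p₁ * ENNReal.ofReal (ω x) ≤
      ((2 * N) ^ p₁ : ℝ≥0) * t ^ (p₁ / p₀) * ∫⁻ x in ball c r, ENNReal.ofReal (ω x) := by
  have hv0 := volume_ball_ne_zero c hr
  have hvt := volume_ball_ne_top c r
  have hp₁' : 0 ≤ 1 / p₁ := by positivity
  have hp₀' : 0 ≤ 1 / p₀ := by positivity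
  have h := hT c r hr f hf hsupp
  have e₁ : (⨍⁻ x in ball c (3 * r), ‖T f x‖ₑ ^ p₀ ∂volume) ^ (1 / p₀) ≤ t ^ (1 / p₀) := by
    refine ENNReal.rpow_le_rpow ?_ hp₀'
    rw [setLAverage_eq]
    exact ENNReal.div_le_of_le_mul h₁
  have e₂ : (⨆ (c' : EuclideanSpace ℝ (Fin d)) (r' : ℝ) (_ : ball c r ⊆ ball c' r'),
      (⨍⁻ x in ball c' r', ‖f x‖ₑ ^ p₀ ∂volume) ^ (1 / p₀)) ≤ t ^ (1 / p₀) := by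
    refine iSup_le fun c' => iSup_le fun r' => iSup_le fun hB => ENNReal.rpow_le_rpow ?_ hp₀'
    rw [setLAverage_eq]
    exact ENNReal.div_le_of_le_mul (h₂ c' r' hB)
  have h' : (⨍⁻ x in ball c r, ‖T f x‖ₑ ^ p₁ * ENNReal.ofReal (ω x) ∂volume) ^ (1 / p₁) ≤
      N * (t ^ (1 / p₀) + t ^ (1 / p₀)) *
        (⨍⁻ x in ball c r, ENNReal.ofReal (ω x) ∂volume) ^ (1 / p₁) := h.trans (by gcongr)
  have h'' := ENNReal.rpow_le_rpow h' hp₁.le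
  rw [ENNReal.mul_rpow_of_nonneg _ _ hp₁.le, ← ENNReal.rpow_mul, ← ENNReal.rpow_mul,
    one_div_mul_cancel hp₁.ne', ENNReal.rpow_one, ENNReal.rpow_one, setLAverage_eq,
    setLAverage_eq, ← mul_div_assoc, ENNReal.div_le_iff hv0 hvt,
    ENNReal.div_mul_cancel hv0 hvt] at h''
  refine h''.trans_eq ?_
  congr 1
  rw [show N * (t ^ (1 / p₀) + t ^ (1 / p₀)) = (2 * N : ℝ≥0) * t ^ (1 / p₀) by push_cast; ring,
    ENNReal.mul_rpow_of_nonneg _ _ hp₁.le, ← ENNReal.rpow_mul, one_div_mul_eq_div,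
    ENNReal.coe_rpow_of_nonneg _ hp₁.le]

theorem hasReverseHolderDecomposition_of_operator {K N : ℝ≥0} {q q' : ℝ} {A : ℝ≥0}
    {ω : EuclideanSpace ℝ (Fin d) → ℝ} {w σ h g : EuclideanSpace ℝ (Fin d) → ℝ≥0∞}
    (hp₀ : 0 < p₀) (hp₁ : 0 < p₁)
    (hsub : IsSublinearWith K T) (hT : IsLpBoundedWith p₀ C₀ T)
    (hRH : WeightedReverseHolder p₀ p₁ N ω T) (P : IsMuckenhouptPair q q' A w σ)
    (hw : (fun x => ENNReal.ofReal (ω x)) =ᵐ[volume] w) (hf : IsBoundedCompactlySupported f)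
    (hh : h =ᵐ[volume] fun x => ‖T f x‖ₑ ^ p₀) (hg : g =ᵐ[volume] fun x => ‖f x‖ₑ ^ p₀) :
    HasReverseHolderDecomposition (p₁ / p₀) ((2 * K) ^ p₀) (2 * C₀ ^ p₀) ((2 * N) ^ p₁) w h g := by
  intro c r hr
  set B := ball c (4 * r) with hB
  have hf₁ : IsBoundedCompactlySupported (B.indicator f) := hf.indicator measurableSet_ball
  have hf₂ : IsBoundedCompactlySupported (Bᶜ.indicator f) := hf.indicator measurableSet_ball.compl
  set f₁ := B.indicator f with hf₁'
  set f₂ := Bᶜ.indicator f with hf₂'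
  have hadd : f₁ + f₂ = f := indicator_self_add_compl B f
  have hadd' : f + -f₁ = f₂ := by rw [← hadd]; abel
  have m₁ := hT.aemeasurable hf₁
  have m₂ := hT.aemeasurable hf₂
  have m₃ := hT.aemeasurable hf₁.neg
  have hint : ∫⁻ x, ‖f₁ x‖ₑ ^ p₀ = ∫⁻ x in B, g x := by
    rw [← lintegral_indicator measurableSet_ball]
    refine lintegral_congr_ae ?_
    filter_upwards [hg] with x hx
    by_cases hxB : x ∈ B
    · rw [hf₁', indicator_of_mem hxB, indicator_of_mem (show x ∈ ball c (4 * r) from hxB), hx]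
    · rw [hf₁', indicator_of_notMem hxB,
        indicator_of_notMem (show x ∉ ball c (4 * r) from hxB), enorm_zero,
        ENNReal.zero_rpow_of_pos hp₀]
  -- Bounding `T f₂` uses `f₂ = f + (-f₁)`, and sublinearity does not compare `T (-f₁)` with `T f₁`.
  -- Both therefore enter `h₁`, whence the factor `2` in `2 * C₀ ^ p₀`.
  refine ⟨fun x => m₁.mk _ x + m₃.mk _ x, m₂.mk, m₁.measurable_mk.add m₃.measurable_mk,
    m₂.measurable_mk, ?_, ?_, ?_, fun t ht₁ ht₂ => ?_⟩
  · filter_upwards [hh, hsub f₁ f₂ hf₁ hf₂, m₁.ae_eq_mk, m₂.ae_eq_mk] with x h1 h2 h3 h4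
    rw [hadd] at h2
    rw [h1, ← h3, ← h4]
    refine (enorm_rpow_le_of_norm_le h2 hp₀.le).trans ?_
    gcongr
    exact le_self_add
  · filter_upwards [hh, hsub f (-f₁) hf hf₁.neg, m₃.ae_eq_mk, m₂.ae_eq_mk] with x h1 h2 h3 h4
    rw [hadd'] at h2
    rw [h1, ← h3, ← h4]
    refine (enorm_rpow_le_of_norm_le h2 hp₀.le).trans ?_
    gcongr
    exact le_add_self
  · rw [lintegral_add_left m₁.measurable_mk, ← lintegral_congr_ae m₁.ae_eq_mk,
      ← lintegral_congr_ae m₃.ae_eq_mk]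
    have h1 := hT.lintegral_rpow_le hp₀ hf₁
    have h2 := hT.lintegral_rpow_le hp₀ hf₁.neg
    simp only [Pi.neg_apply, enorm_neg] at h2
    rw [hint] at h1 h2
    refine (add_le_add h1 h2).trans_eq ?_
    rw [ENNReal.coe_mul, ENNReal.coe_ofNat]
    ring
  · have hsupp : tsupport f₂ ⊆ (ball c (4 * r))ᶜ :=
      closure_minimal support_indicator_subset isOpen_ball.isClosed_compl
    have key := hRH.setLIntegral_le hp₀ hp₁ hr hf₂ hsupp (t := t) ?_ ?_
    · rw [P.setLIntegral_withDensity measurableSet_ball, P.withDensity_ball]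
      have e1 : ∫⁻ x in ball c r, w x * m₂.mk _ x ^ (p₁ / p₀) =
          ∫⁻ x in ball c r, ‖T f₂ x‖ₑ ^ p₁ * ENNReal.ofReal (ω x) := by
        refine lintegral_congr_ae (ae_restrict_of_ae ?_)
        filter_upwards [hw, m₂.ae_eq_mk] with x h1 h2
        rw [← h1, ← h2, ← ENNReal.rpow_mul, mul_div_cancel₀ _ hp₀.ne', mul_comm]
      have e2 : ∫⁻ x in ball c r, w x = ∫⁻ x in ball c r, ENNReal.ofReal (ω x) :=
        lintegral_congr_ae (ae_restrict_of_ae hw.symm)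
      rw [e1, e2]
      exact key
    · rw [lintegral_congr_ae (ae_restrict_of_ae m₂.ae_eq_mk)]
      exact ht₁
    · intro c' r' hsub'
      refine le_trans (lintegral_mono_ae (ae_restrict_of_ae ?_)) (ht₂ c' r' hsub')
      filter_upwards [hg] with x hx
      rw [hx]
      exact ENNReal.rpow_le_rpow (enorm_indicator_le_enorm_self f x) hp₀.le

end Operator

theorem IsMuckenhouptPair.lintegral_rpow_withDensity {d : ℕ} {q q' p p₀ : ℝ} {A : ℝ≥0}
    {ω : EuclideanSpace ℝ (Fin d) → ℝ} {w σ v : EuclideanSpace ℝ (Fin d) → ℝ≥0∞}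
    (P : IsMuckenhouptPair q q' A w σ) (hp₀ : 0 < p₀)
    (hw : (fun x => ENNReal.ofReal (ω x)) =ᵐ[volume] w)
    {G : Type*} [NormedAddCommGroup G] {u : EuclideanSpace ℝ (Fin d) → G}
    (huv : (fun x => ‖u x‖ₑ ^ p₀) =ᵐ[volume] v) :
    ∫⁻ x, v x ^ (p / p₀) ∂(volume.withDensity w) = ∫⁻ x, ‖u x‖ₑ ^ p * ENNReal.ofReal (ω x) := by
  rw [P.lintegral_withDensity]
  refine lintegral_congr_ae ?_
  filter_upwards [huv, hw] with x h1 h2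
  rw [← h1, ← h2, ← ENNReal.rpow_mul, mul_div_cancel₀ _ hp₀.ne', mul_comm]

/-! ### The main theorem -/

theorem theorem3p1 (d : ℕ) (hd : 1 ≤ d) (p₀ p p₁ : ℝ) (hp₀ : 0 < p₀) (hp₀p : p₀ < p)
    (hpp₁ : p < p₁) (K C₀ N A : ℝ≥0) (hK : 1 ≤ K) :
    ∃ C : ℝ≥0,
      ∀ (E F : Type*) [NormedAddCommGroup E] [NormedSpace ℝ E]
        [NormedAddCommGroup F] [NormedSpace ℝ F]
        (T : (EuclideanSpace ℝ (Fin d) → E) → (EuclideanSpace ℝ (Fin d) → F))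
        (ω : EuclideanSpace ℝ (Fin d) → ℝ),
        IsSublinearWith K T →
        IsApWeight d (p / p₀) A ω →
        IsLpBoundedWith p₀ C₀ T →
        WeightedReverseHolder p₀ p₁ N ω T →
        ∀ f : EuclideanSpace ℝ (Fin d) → E, IsBoundedCompactlySupported f →
          ∫⁻ x, ‖T f x‖ₑ ^ p * ENNReal.ofReal (ω x) ≤
            C * ∫⁻ x, ‖f x‖ₑ ^ p * ENNReal.ofReal (ω x) := by
  have hp₁ : 0 < p₁ := by linarith
  have hq : 1 < p / p₀ := (one_lt_div hp₀).mpr hp₀p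
  have hqs : p / p₀ < p₁ / p₀ := div_lt_div_of_pos_right hpp₁ hp₀
  have hconj := Real.HolderConjugate.conjExponent hq
  have hK' : 1 ≤ (2 * K) ^ p₀ :=
    NNReal.one_le_rpow (hK.trans (le_mul_of_one_le_left zero_le one_le_two)) hp₀.le
  obtain ⟨C, hC⟩ := exists_lintegral_rpow_withDensity_le d hd (q' := (p / p₀).conjExponent)
    (A ^ (1 / (p / p₀))) (2 * C₀ ^ p₀) ((2 * N) ^ p₁) hqs hK'
  refine ⟨C, fun E F _ _ _ _ T ω hsub hω hT hRH f hf => ?_⟩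
  -- The `A_q` condition admits `ω = 0` almost everywhere, which no pair represents; the left side
  -- is then zero.
  rcases hω.ae_eq_zero_or_ae_ne_zero hq with h0 | h0
  · have : ∫⁻ x, ‖T f x‖ₑ ^ p * ENNReal.ofReal (ω x) = 0 := by
      rw [lintegral_congr_ae (g := fun _ => 0) (h0.mono fun x hx => by simp [hx]), lintegral_zero]
    rw [this]
    exact zero_le
  obtain ⟨w, σ, P, hw⟩ := hω.exists_isMuckenhouptPair hconj h0
  have mT := hT.aemeasurable hf
  have mf : AEMeasurable (fun x => ‖f x‖ₑ ^ p₀) volume :=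
    hf.aestronglyMeasurable.enorm.pow_const _
  have hfin : ∫⁻ x, mT.mk _ x ≠ ∞ := by
    rw [← lintegral_congr_ae mT.ae_eq_mk]
    exact hT.lintegral_ne_top hp₀ hf
  have key := hC w σ P _ _ mT.measurable_mk mf.measurable_mk hfin
    (hasReverseHolderDecomposition_of_operator hp₀ hp₁ hsub hT hRH P hw hf mT.ae_eq_mk.symm
      mf.ae_eq_mk.symm)
  rw [P.lintegral_rpow_withDensity hp₀ hw mT.ae_eq_mk,
    P.lintegral_rpow_withDensity hp₀ hw mf.ae_eq_mk] at key
  exact key
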